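/- Let $P\subseteq\mathbb R^n$ be a polytope, $0\le k\le n$, and let $\mathcal X=P\cap(\mathbb Z^k\times\mathbb R^{n-k})$ be non-empty. Let $\mathcal U\subseteq\mathbb R^m$ be a finite set or a polytope, and let $f_1,f_2$ be real-valued functions of $(x,\xi)$, defined for $x\in\mathcal X$ and $\xi\in\mathcal U$, that are linear in $x\in\mathcal X$ for every fixed $\xi\in\mathcal U$. For $\emptyset\ne\mathcal V\subseteq\mathcal U$ put $f^{\mathcal V}(x)=(\sup_{\xi\in\mathcal V}f_1(x,\xi),\sup_{\xi\in\mathcal V}f_2(x,\xi))$, and let $\mathrm{BRO}(\mathcal V)$ be the biobjective problem $\min_{x\in\mathcal X}f^{\mathcal V}(x)$. Vectors are compared componentwise. For $Y\subseteq\mathbb R^2$, a point $y\in Y$ is nondominated if no $y'\in Y\setminus\{y\}$ satisfies $y'\le y$, and it is extreme supported nondominated if no convex combination $\sum_i\mu_iy^{(i)}$ of nondominated points $y^{(i)}\in Y\setminus\{y\}$ satisfies $\sum_i\mu_iy^{(i)}\le y$. A set $R\subseteq\mathcal X$ is a representative set of extreme supported efficient solutions of $\min_{x\in\mathcal X}g(x)$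 if $g(R)$ is the set of extreme supported nondominated points of $g(\mathcal X)$. Dichotomic search for $\min_{x\in\mathcal X}g(x)$, $g=(g_1,g_2)$: choose $x^L$ minimizing $g_2$ among the minimizers of $g_1$, and $x^R$ minimizing $g_1$ among the minimizers of $g_2$. If $g(x^L)=g(x^R)$, let $X^*=\{x^L\}$ and $\mathcal L=\emptyset$; otherwise let $X^*=\{x^L,x^R\}$ and $\mathcal L=\{(g(x^L),g(x^R))\}$. While $\mathcal L\neq\emptyset$, remove some $(y^l,y^r)$ from $\mathcal L$, put $\lambda=(y^l_2-y^r_2,\,y^r_1-y^l_1)$, choose $x^*\in\arg\min_{x\in\mathcal X}\lambda^{T}g(x)$ and, if $\lambda^Tg(x^*)<\lambda^Ty^l$, add $x^*$ to $X^*$ and $(y^l,g(x^*)),(g(x^*),y^r)$ to $\mathcal L$. Finally remove from $X^*$ simultaneously all $x$ for which some convex combination of points of $g(X^*)\setminus\{g(x)\}$ is $\le g(x)$, and return the remaining set together with its image under $g$. Algorithm ROA (robust optimizer's approach) starts from a finite non-empty set $\mathcal U^{(0)}\subseteq\mathcal U$. In iteration $j=0,1,2,\dots$ it obtains $X^{(j)*}$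 by dichotomic search for $\mathrm{BRO}(\mathcal U^{(j)})$ (optimization) and then, for every $x\in X^{(j)*}$ and $i=1,2$, chooses one $\xi\in\arg\max_{\xi\in\mathcal U}f_i(x,\xi)$; the set $\mathcal U^{(j+1)}$ consists of $\mathcal U^{(j)}$ and all the chosen scenarios (pessimization). It stops after the first iteration $j$ with $f^{\mathcal U}(x)=f^{\mathcal U^{(j)}}(x)$ for all $x\in X^{(j)*}$, and returns $X^{(j)*}$ (together with its image and $\mathcal U^{(j+1)}$). The number of iterations is then $j+1$. The following holds for all choices of minimizers, maximizers and list elements in the algorithm. (i) Let $\mathcal U$ be finite. Then all steps of Algorithm ROA can be carried out, all its loops (including those of dichotomic search) terminate, and it returns a representative set of extreme supported efficient solutions of $\mathrm{BRO}(\mathcal U)$ after at most $|\mathcal U|$ iterations. (ii) Let $\mathcal U$ be finite or a polytope, and suppose that for all $x\in\mathcal X$ and $i=1,2$ the function $f_i(x,\cdot)$ is defined, continuous and quasi-convex on $\mathrm{conv}(\mathcal U)$. Let $\mathrm{ext}(\mathcal U)$ be the set of extreme points of $\mathrm{conv}(\mathcal U)$, and suppose that pessimization always chooses a point of $\mathrm{ext}(\mathcal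 U)$. Then all steps can be carried out, all loops terminate, and Algorithm ROA returns a representative set of extreme supported efficient solutions of $\mathrm{BRO}(\mathcal U)$ after at most $|\mathrm{ext}(\mathcal U)|$ iterations if $\mathcal U^{(0)}$ contains a point of $\mathrm{ext}(\mathcal U)$, and after at most $|\mathrm{ext}(\mathcal U)|+1$ iterations for every finite non-empty $\mathcal U^{(0)}\subseteq\mathcal U$. -/

import Mathlib

/-- A polytope in `ℝᵈ`: a bounded set of the form `{x | A x ≤ b}` with finitely many rows. -/
def IsPolytope {d : ℕ} (P : Set (Fin d → ℝ)) : Prop :=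
  (∃ (r : ℕ) (A : Matrix (Fin r) (Fin d) ℝ) (b : Fin r → ℝ), P = {x | A.mulVec x ≤ b}) ∧
    Bornology.IsBounded P

/-- `P ∩ (ℤᵏ × ℝⁿ⁻ᵏ)`: the first `k` coordinates are integers. -/
def mixedIntegerPart {n : ℕ} (P : Set (Fin n → ℝ)) (k : ℕ) : Set (Fin n → ℝ) :=
  {x | x ∈ P ∧ ∀ j : Fin n, (j : ℕ) < k → ∃ z : ℤ, x j = z}

/-- The worst-case objective `x ↦ (sup_{ξ ∈ V} f₁(x, ξ), sup_{ξ ∈ V} f₂(x, ξ))`. -/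
noncomputable def robustObj {n m : ℕ} (f : Fin 2 → (Fin n → ℝ) → (Fin m → ℝ) → ℝ)
    (V : Set (Fin m → ℝ)) (x : Fin n → ℝ) : Fin 2 → ℝ :=
  fun i => sSup ((fun ξ => f i x ξ) '' V)

/-- The points of `Y` that no other point of `Y` dominates (`≤` is componentwise). -/
def nondominated (Y : Set (Fin 2 → ℝ)) : Set (Fin 2 → ℝ) :=
  {y | y ∈ Y ∧ ¬ ∃ y' ∈ Y, y' ≤ y ∧ y' ≠ y}

/-- The extreme supported nondominated points of `Y`: no convex combination of nondominated
points different from `y` is componentwise at most `y`. -/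
def extremeSupported (Y : Set (Fin 2 → ℝ)) : Set (Fin 2 → ℝ) :=
  {y | y ∈ Y ∧ ¬ ∃ z ∈ convexHull ℝ (nondominated Y \ {y}), z ≤ y}

/-- `R` is a representative set of extreme supported efficient solutions of `min_{x ∈ X} g(x)`:
its image is the set of extreme supported nondominated points. -/
def IsRepresentativeESE {n : ℕ} (X : Set (Fin n → ℝ)) (g : (Fin n → ℝ) → Fin 2 → ℝ)
    (R : Set (Fin n → ℝ)) : Prop :=
  R ⊆ X ∧ g '' R = extremeSupported (g '' X)

/-- The minimizers of `h` over `S`. -/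
def argminSet {α : Type*} (h : α → ℝ) (S : Set α) : Set α :=
  {x | x ∈ S ∧ ∀ x' ∈ S, h x ≤ h x'}

/-- The maximizers of `h` over `S`. -/
def argmaxSet {α : Type*} (h : α → ℝ) (S : Set α) : Set α :=
  {x | x ∈ S ∧ ∀ x' ∈ S, h x' ≤ h x}

/-! Dichotomic search for `min_{x ∈ X} (g₁(x), g₂(x))`, as a nondeterministic transition system:
every choice of a minimizer and every order of processing the list is allowed. -/

/-- The variables of dichotomic search: the list of pairs `(yˡ, yʳ)` still to be treated, the
images found and the solutions found. -/
structure DichState (n : ℕ) where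
  pending : Set ((Fin 2 → ℝ) × (Fin 2 → ℝ))
  points : Set (Fin 2 → ℝ)
  sols : Set (Fin n → ℝ)

/-- `x` minimizes objective `j` among the minimizers of objective `i`. -/
def IsLexMin {n : ℕ} (X : Set (Fin n → ℝ)) (g : (Fin n → ℝ) → Fin 2 → ℝ) (i j : Fin 2)
    (x : Fin n → ℝ) : Prop :=
  ∃ ε : ℝ, IsLeast ((fun x' => g x' i) '' X) ε ∧
    x ∈ argminSet (fun x' => g x' j) {x' | x' ∈ X ∧ g x' i ≤ ε}

/-- Initialization with the two lexicographically optimal solutions. -/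
inductive DichInit {n : ℕ} (X : Set (Fin n → ℝ)) (g : (Fin n → ℝ) → Fin 2 → ℝ) :
    DichState n → Prop
  | one (xL xR : Fin n → ℝ) (hL : IsLexMin X g 0 1 xL) (hR : IsLexMin X g 1 0 xR)
      (h : g xL = g xR) : DichInit X g ⟨∅, {g xL}, {xL}⟩
  | two (xL xR : Fin n → ℝ) (hL : IsLexMin X g 0 1 xL) (hR : IsLexMin X g 1 0 xR)
      (h : g xL ≠ g xR) : DichInit X g ⟨{(g xL, g xR)}, {g xL, g xR}, {xL, xR}⟩

/-- `λᵀ y` for the weights `λ = (yˡ₂ - yʳ₂, yʳ₁ - yˡ₁)` given by the pair `p = (yˡ, yʳ)`. -/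
def weightedSum (p : (Fin 2 → ℝ) × (Fin 2 → ℝ)) (y : Fin 2 → ℝ) : ℝ :=
  (p.1 1 - p.2 1) * y 0 + (p.2 0 - p.1 0) * y 1

/-- One pass through the loop of dichotomic search: remove a pair from the list, solve the
weighted-sum problem and, if the solution found is strictly better than the pair, record it. -/
inductive DichStep {n : ℕ} (X : Set (Fin n → ℝ)) (g : (Fin n → ℝ) → Fin 2 → ℝ) :
    DichState n → DichState n → Prop
  | improve (s : DichState n) (p : (Fin 2 → ℝ) × (Fin 2 → ℝ)) (hp : p ∈ s.pending)
      (x : Fin n → ℝ) (hx : x ∈ argminSet (fun x' => weightedSum p (g x')) X)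
      (h : weightedSum p (g x) < weightedSum p p.1) :
      DichStep X g s
        ⟨(s.pending \ {p}) ∪ {(p.1, g x), (g x, p.2)}, insert (g x) s.points, insert x s.sols⟩
  | discard (s : DichState n) (p : (Fin 2 → ℝ) × (Fin 2 → ℝ)) (hp : p ∈ s.pending)
      (x : Fin n → ℝ) (hx : x ∈ argminSet (fun x' => weightedSum p (g x')) X)
      (h : ¬ weightedSum p (g x) < weightedSum p p.1) :
      DichStep X g s ⟨s.pending \ {p}, s.points, s.sols⟩

/-- The images found by dichotomic search that are not componentwise at least a convex
combination of other images found. -/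
def DichState.cleanPoints {n : ℕ} (s : DichState n) : Set (Fin 2 → ℝ) :=
  {y | y ∈ s.points ∧ ¬ ∃ z ∈ convexHull ℝ (s.points \ {y}), z ≤ y}

/-- The solutions found by dichotomic search whose images survive the cleaning. -/
def DichState.cleanSols {n : ℕ} (s : DichState n) (g : (Fin n → ℝ) → Fin 2 → ℝ) :
    Set (Fin n → ℝ) :=
  {x | x ∈ s.sols ∧ g x ∈ s.cleanPoints}

/-! The robust optimizer's approach: optimization-pessimization, with dichotomic search in the
optimization step. -/

/-- Configurations. The number `k` counts the completed iterations of the outer loop, `V` is the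
current scenario set.
* `loop k V`: the next outer iteration is about to begin;
* `search k V s`: inside dichotomic search for the scenario set `V`;
* `pess k V R Y`: dichotomic search has returned `R` and `Y`, pessimization comes next;
* `done k R Y V`: the algorithm has stopped after `k` iterations and has returned the solutions
  `R`, the points `Y` and the scenario set `V`. -/
inductive ROAState (n m : ℕ)
  | loop (k : ℕ) (V : Set (Fin m → ℝ))
  | search (k : ℕ) (V : Set (Fin m → ℝ)) (s : DichState n)
  | pess (k : ℕ) (V : Set (Fin m → ℝ)) (R : Set (Fin n → ℝ)) (Y : Set (Fin 2 → ℝ))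
  | done (k : ℕ) (R : Set (Fin n → ℝ)) (Y : Set (Fin 2 → ℝ)) (V : Set (Fin m → ℝ))

/-- The transitions. Pessimization picks, for every solution `x` in `R` and every objective `i`, a
maximizer `w x i` of `f i x` over `U`; the set `W` is the set of scenarios that the method used
for pessimization can return. -/
inductive ROAStep {n m : ℕ} (X : Set (Fin n → ℝ)) (U : Set (Fin m → ℝ))
    (f : Fin 2 → (Fin n → ℝ) → (Fin m → ℝ) → ℝ) (W : Set (Fin m → ℝ)) :
    ROAState n m → ROAState n m → Prop
  | start (k : ℕ) (V : Set (Fin m → ℝ)) (s : DichState n) (h : DichInit X (robustObj f V) s) :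
      ROAStep X U f W (.loop k V) (.search k V s)
  | inner (k : ℕ) (V : Set (Fin m → ℝ)) (s t : DichState n)
      (h : DichStep X (robustObj f V) s t) :
      ROAStep X U f W (.search k V s) (.search k V t)
  | finish (k : ℕ) (V : Set (Fin m → ℝ)) (s : DichState n) (h : s.pending = ∅) :
      ROAStep X U f W (.search k V s) (.pess k V (s.cleanSols (robustObj f V)) s.cleanPoints)
  | again (k : ℕ) (V : Set (Fin m → ℝ)) (R : Set (Fin n → ℝ)) (Y : Set (Fin 2 → ℝ))
      (w : (Fin n → ℝ) → Fin 2 → Fin m → ℝ) (hw : ∀ x ∈ R, ∀ i, w x i ∈ argmaxSet (f i x) U ∩ W)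
      (h : ¬ ∀ x ∈ R, robustObj f U x = robustObj f V x) :
      ROAStep X U f W (.pess k V R Y) (.loop (k + 1) (V ∪ {ξ | ∃ x ∈ R, ∃ i, ξ = w x i}))
  | halt (k : ℕ) (V : Set (Fin m → ℝ)) (R : Set (Fin n → ℝ)) (Y : Set (Fin 2 → ℝ))
      (w : (Fin n → ℝ) → Fin 2 → Fin m → ℝ) (hw : ∀ x ∈ R, ∀ i, w x i ∈ argmaxSet (f i x) U ∩ W)
      (h : ∀ x ∈ R, robustObj f U x = robustObj f V x) :
      ROAStep X U f W (.pess k V R Y) (.done (k + 1) R Y (V ∪ {ξ | ∃ x ∈ R, ∃ i, ξ = w x i}))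

/-- Started from the scenario set `U₀`, whatever choices are made,
* the algorithm has no infinite run (neither in the outer loop nor in dichotomic search);
* it never gets stuck: at every reachable configuration other than a final one, a next step exists
  (all the minima and maxima that are needed are attained);
* when it stops, it has made at most `N` iterations of the outer loop, and the solutions it
  returns are a representative set of extreme supported efficient solutions for `U`. -/
def ROAWorks {n m : ℕ} (X : Set (Fin n → ℝ)) (U : Set (Fin m → ℝ))
    (f : Fin 2 → (Fin n → ℝ) → (Fin m → ℝ) → ℝ) (W U₀ : Set (Fin m → ℝ)) (N : ℕ) : Prop :=
  Acc (fun t s => ROAStep X U f W s t) (.loop 0 U₀) ∧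
  (∀ s, Relation.ReflTransGen (ROAStep X U f W) (.loop 0 U₀) s →
    (∃ t, ROAStep X U f W s t) ∨ ∃ k R Y V, s = .done k R Y V) ∧
  (∀ k R Y V, Relation.ReflTransGen (ROAStep X U f W) (.loop 0 U₀) (.done k R Y V) →
    k ≤ N ∧ IsRepresentativeESE X (robustObj f U) R)

/-! Everything is read off from upper hulls `upHull T`, that is, conv T + ℝ²₊. If T consists of
nondominated points of Y and Y ⊆ `upHull T` (`Represents`), then the irredundant points of T are
exactly the extreme supported nondominated points of Y (`Represents.irredundant_eq`), and for finite
T they still generate Y (`Represents.irredundant`). Dichotomic search therefore only has to produce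
such a T; its invariant `DichInv` says that every image point outside the current upper hull lies
below a pending chord.

Dichotomic search terminates because a finite set E of image points generates the lower boundary:
the feasible set is a finite union of polytopes, and over each of them the epigraph of a vector of
maxima of finitely many linear functions is a polyhedron with finitely many extreme points
(`exists_finite_generators`). An improving step splits a chord into two, each with fewer points of E
between its ends (`DichInv.acc`).

For the outer loop, V ⊆ U makes the objective for V a lower bound of the objective for U. If both
agree on the solutions returned for V, these solutions also represent the problem for U
(`Represents.transfer`). If not, some chosen worst case is missing from V, so every iteration but
the last adds a point of the finite set W from which pessimization draws (`ScenarioInv.ssubset`).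
Here W is U itself or the set of extreme points, which contains maximizers by quasiconvexity. -/

/-! ### Upper hulls, irredundant points and representation of the lower boundary -/

/-- The points that are componentwise at least a convex combination of points of `S`. -/
def upHull (S : Set (Fin 2 → ℝ)) : Set (Fin 2 → ℝ) :=
  {y | ∃ z ∈ convexHull ℝ S, z ≤ y}

theorem upHull_mono {S T : Set (Fin 2 → ℝ)} (h : S ⊆ T) : upHull S ⊆ upHull T :=
  fun _ ⟨z, hz, hzy⟩ => ⟨z, convexHull_mono h hz, hzy⟩

theorem subset_upHull (S : Set (Fin 2 → ℝ)) : S ⊆ upHull S :=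
  fun y hy => ⟨y, subset_convexHull ℝ S hy, le_rfl⟩

theorem upHull_of_le {S : Set (Fin 2 → ℝ)} {y z : Fin 2 → ℝ} (hz : z ∈ upHull S) (h : z ≤ y) :
    y ∈ upHull S := by
  obtain ⟨w, hw, hwz⟩ := hz
  exact ⟨w, hw, hwz.trans h⟩

theorem convex_upHull (S : Set (Fin 2 → ℝ)) : Convex ℝ (upHull S) := by
  rintro y ⟨z, hz, hzy⟩ y' ⟨z', hz', hzy'⟩ a b ha hb hab
  exact ⟨a • z + b • z', convex_convexHull ℝ S hz hz' ha hb hab,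
    add_le_add (smul_le_smul_of_nonneg_left hzy ha) (smul_le_smul_of_nonneg_left hzy' hb)⟩

theorem upHull_subset_upHull {S T : Set (Fin 2 → ℝ)} (h : S ⊆ upHull T) :
    upHull S ⊆ upHull T := by
  rintro y ⟨z, hz, hzy⟩
  exact upHull_of_le (convexHull_min h (convex_upHull T) hz) hzy

/-- The points of `T` that are not componentwise at least a convex combination of other points
of `T`. -/
def irredundant (T : Set (Fin 2 → ℝ)) : Set (Fin 2 → ℝ) :=
  {y | y ∈ T ∧ y ∉ upHull (T \ {y})}

theorem irredundant_subset (T : Set (Fin 2 → ℝ)) : irredundant T ⊆ T := fun _ h => h.1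

theorem irredundant_irredundant (T : Set (Fin 2 → ℝ)) :
    irredundant (irredundant T) = irredundant T := by
  refine Set.Subset.antisymm (irredundant_subset _) fun y hy => ⟨hy, fun h => hy.2 ?_⟩
  exact upHull_mono (Set.sdiff_subset_sdiff_left (irredundant_subset T)) h

/-- Irredundancy of a point in a generating subset of an antichain is irredundancy in the whole
antichain. -/
theorem irredundant_subset_irredundant {S T : Set (Fin 2 → ℝ)} (hST : S ⊆ T)
    (hT : ∀ t ∈ T, ∀ t' ∈ T, t ≤ t' → t = t') (hTS : T ⊆ upHull S) :
    irredundant S ⊆ irredundant T := by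
  rintro y ⟨hyS, hy⟩
  refine ⟨hST hyS, ?_⟩
  rintro ⟨z, hz, hzy⟩
  -- C is the region above the open rays from y through the hull of the other points of S. It is
  -- convex and contains T \ {y}: a point of T is at least y + r(t - y), and r = 0 would put it
  -- above y, against the antichain property. So C contains z, and y + r(t - y) ≤ z ≤ y gives t ≤ y,
  -- contradicting irredundancy of y in S.
  let C : Set (Fin 2 → ℝ) :=
    {p | ∃ r : ℝ, 0 < r ∧ ∃ t ∈ convexHull ℝ (S \ {y}), y + r • (t - y) ≤ p}
  have hC : Convex ℝ C := by
    rintro p ⟨r, hr, t, ht, hp⟩ p' ⟨r', hr', t', ht', hp'⟩ a b ha hb hab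
    have hpos : 0 < a * r + b * r' := by
      rcases ha.eq_or_lt with rfl | ha'
      · have : b = 1 := by linarith
        subst this; simpa using hr'
      · have := mul_pos ha' hr
        have := mul_nonneg hb hr'.le
        linarith
    refine ⟨a * r + b * r', hpos,
      (a * r / (a * r + b * r')) • t + (b * r' / (a * r + b * r')) • t',
      convex_convexHull ℝ _ ht ht' (by positivity) (by positivity) (by field_simp), ?_⟩
    refine le_trans (le_of_eq ?_)
      (add_le_add (smul_le_smul_of_nonneg_left hp ha) (smul_le_smul_of_nonneg_left hp' hb))
    have hb' : b = 1 - a := by linarith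
    ext i
    simp only [Pi.add_apply, Pi.smul_apply, Pi.sub_apply, smul_eq_mul]
    field_simp
    rw [hb']; ring
  have hsub : T \ {y} ⊆ C := by
    rintro q ⟨hqT, hqy⟩
    obtain ⟨w, hw, hwq⟩ := hTS hqT
    have hne : (S \ {y}).Nonempty := by
      by_contra hemp
      rw [Set.not_nonempty_iff_eq_empty, Set.sdiff_eq_empty] at hemp
      have := convexHull_mono (𝕜 := ℝ) hemp hw
      rw [convexHull_singleton, Set.mem_singleton_iff] at this
      exact hqy (hT y (hST hyS) q hqT (this ▸ hwq)).symm
    rw [← Set.insert_sdiff_self_of_mem hyS, convexHull_insert hne] at hw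
    obtain ⟨y', hy', t, ht, hw'⟩ := mem_convexJoin.1 hw
    rw [Set.mem_singleton_iff] at hy'
    subst hy'
    rw [segment_eq_image'] at hw'
    obtain ⟨r, ⟨hr0, -⟩, rfl⟩ := hw'
    rcases hr0.eq_or_lt with rfl | hr
    · refine absurd (hT y' (hST hyS) q hqT ?_).symm hqy
      simpa using hwq
    · exact ⟨r, hr, t, ht, hwq⟩
  obtain ⟨r, hr, t, ht, h⟩ := convexHull_min hsub hC hz
  refine hy ⟨t, ht, fun i => ?_⟩
  have h1 := (h.trans hzy) i
  simp only [Pi.add_apply, Pi.smul_apply, Pi.sub_apply, smul_eq_mul] at h1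
  by_contra hcon
  have := mul_pos hr (sub_pos.2 (not_le.1 hcon))
  linarith

theorem nondominated_antichain {Y : Set (Fin 2 → ℝ)} :
    ∀ t ∈ nondominated Y, ∀ t' ∈ nondominated Y, t ≤ t' → t = t' := by
  intro t ht t' ht' hle
  by_contra hne
  exact ht'.2 ⟨t, ht.1, hle, hne⟩

/-- `T` consists of nondominated points of `Y` and generates the lower boundary of `Y`. -/
structure Represents (Y T : Set (Fin 2 → ℝ)) : Prop where
  nondom : T ⊆ nondominated Y
  cover : Y ⊆ upHull T

/-- A generating set cannot miss an extreme supported y, since otherwise points of `nondominated Y \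
{y}` would already generate y. The converse is the antichain lemma applied to T inside `nondominated
Y`. -/
theorem Represents.irredundant_eq {Y T : Set (Fin 2 → ℝ)} (h : Represents Y T) :
    irredundant T = extremeSupported Y := by
  refine Set.Subset.antisymm (fun y hy => ?_) ?_
  · have := irredundant_subset_irredundant h.nondom nondominated_antichain
      (fun t ht => h.cover ht.1) hy
    exact ⟨this.1.1, this.2⟩
  · rintro y ⟨hyY, hy⟩
    have hyT : y ∈ T := by
      by_contra hyT
      have hsub : T ⊆ nondominated Y \ {y} := fun t ht =>
        ⟨h.nondom ht, fun hty => hyT (hty ▸ ht)⟩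
      exact hy (upHull_mono hsub (h.cover hyY))
    exact ⟨hyT, fun hcon => hy (upHull_mono (Set.sdiff_subset_sdiff_left h.nondom) hcon)⟩

/-- This makes the simultaneous cleaning harmless. In a minimal generating subset S of T every point
is irredundant, hence irredundant in T by the antichain lemma; so the irredundant points of T
contain the generating set S. -/
theorem Represents.irredundant {Y T : Set (Fin 2 → ℝ)} (h : Represents Y T) (hT : T.Finite) :
    Represents Y (irredundant T) := by
  refine ⟨(irredundant_subset T).trans h.nondom, ?_⟩
  have hfin : {S : Set (Fin 2 → ℝ) | S ⊆ T ∧ T ⊆ upHull S}.Finite :=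
    hT.finite_subsets.subset fun S hS => hS.1
  obtain ⟨S, ⟨hST, hTS⟩, hmin⟩ := hfin.exists_minimal ⟨T, subset_rfl, subset_upHull T⟩
  have hS : S ⊆ _root_.irredundant S := by
    refine fun y hy => ⟨hy, fun hcon => ?_⟩
    have h1 : S ⊆ upHull (S \ {y}) := by
      intro q hq
      by_cases hqy : q = y
      · exact hqy ▸ hcon
      · exact subset_upHull _ ⟨hq, hqy⟩
    have h2 := hmin (y := S \ {y})
      ⟨Set.sdiff_subset.trans hST, hTS.trans (upHull_subset_upHull h1)⟩ Set.sdiff_subset hy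
    exact h2.2 rfl
  have hanti : ∀ t ∈ T, ∀ t' ∈ T, t ≤ t' → t = t' := fun t ht t' ht' =>
    nondominated_antichain t (h.nondom ht) t' (h.nondom ht')
  have := hS.trans (irredundant_subset_irredundant hST hanti hTS)
  exact h.cover.trans (upHull_subset_upHull (hTS.trans (upHull_mono this)))

/-- Points that represent the image of `g` also represent the image of a larger function `g'`, if
`g` and `g'` agree on their preimages. -/
theorem Represents.transfer {α : Type*} {X R : Set α} {g g' : α → Fin 2 → ℝ} (hRX : R ⊆ X)
    (hle : ∀ x ∈ X, g x ≤ g' x) (heq : ∀ x ∈ R, g' x = g x)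
    (h : Represents (g '' X) (g '' R)) : Represents (g' '' X) (g' '' R) := by
  have himg : g' '' R = g '' R := Set.image_congr heq
  rw [himg]
  constructor
  · rintro _ ⟨x, hx, rfl⟩
    refine ⟨⟨x, hRX hx, heq x hx⟩, ?_⟩
    rintro ⟨_, ⟨x', hx', rfl⟩, hle', hne⟩
    have hx1 : g x' ≤ g x := (hle x' hx').trans hle'
    have hx2 : g x' = g x := by
      by_contra hne'
      exact (h.nondom ⟨x, hx, rfl⟩).2 ⟨_, ⟨x', hx', rfl⟩, hx1, hne'⟩
    exact hne (le_antisymm hle' (hx2 ▸ hle x' hx'))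
  · rintro _ ⟨x, hx, rfl⟩
    exact upHull_of_le (h.cover ⟨x, hx, rfl⟩) (hle x hx)

/-! ### Supported points and chords in the plane -/

/-- `a` is a nondominated point of `Y` that minimizes a nontrivial weighted sum with nonnegative
weights. -/
structure IsSupportedPoint (Y : Set (Fin 2 → ℝ)) (a : Fin 2 → ℝ) : Prop where
  mem : a ∈ Y
  nondom : ∀ y ∈ Y, y ≤ a → y = a
  weights : ∃ u v : ℝ, 0 ≤ u ∧ 0 ≤ v ∧ 0 < u + v ∧ ∀ y ∈ Y, u * a 0 + v * a 1 ≤ u * y 0 + v * y 1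

theorem fin_two_le {y z : Fin 2 → ℝ} (h0 : y 0 ≤ z 0) (h1 : y 1 ≤ z 1) : y ≤ z := by
  intro i
  fin_cases i
  · exact h0
  · exact h1

theorem fin_two_eq {y z : Fin 2 → ℝ} (h0 : y 0 = z 0) (h1 : y 1 = z 1) : y = z := by
  ext i
  fin_cases i
  · exact h0
  · exact h1

theorem IsSupportedPoint.mem_nondominated {Y : Set (Fin 2 → ℝ)} {a : Fin 2 → ℝ}
    (h : IsSupportedPoint Y a) : a ∈ nondominated Y :=
  ⟨h.mem, fun ⟨y, hy, hle, hne⟩ => hne (h.nondom y hy hle)⟩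

/-- A point of `Y` below the chord through `p.1` and `p.2` lies to the lower right of `p.1`. -/
theorem IsSupportedPoint.lt_of_below_left {Y : Set (Fin 2 → ℝ)}
    {p : (Fin 2 → ℝ) × (Fin 2 → ℝ)} (ha : IsSupportedPoint Y p.1) (hb : p.2 ∈ Y)
    (h0 : p.1 0 < p.2 0) (h1 : p.2 1 < p.1 1) {y : Fin 2 → ℝ} (hy : y ∈ Y)
    (h : weightedSum p y < weightedSum p p.1) : p.1 0 < y 0 ∧ y 1 < p.1 1 := by
  obtain ⟨u, v, hu, hv, huv, hmin⟩ := ha.weights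
  have hay := hmin y hy
  have hab := hmin _ hb
  have hδ : (p.1 1 - p.2 1) * (y 0 - p.1 0) + (p.2 0 - p.1 0) * (y 1 - p.1 1) < 0 := by
    unfold weightedSum at h; linarith
  have key : p.1 0 < y 0 := by
    by_contra! hcon
    have hy1 : p.1 1 < y 1 := by
      by_contra! hcon1
      rw [ha.nondom y hy (fin_two_le hcon hcon1)] at h
      exact lt_irrefl _ h
    -- The terms in u cancel in the sum of `e1` and `e2`, leaving v times the negative quantity of
    -- `hδ`. This forces v = 0, so `p.1` minimizes the first coordinate and y lies vertically above
    -- it, which `hδ` excludes.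
    have e1 : 0 ≤ (p.2 0 - p.1 0) * (u * (y 0 - p.1 0) + v * (y 1 - p.1 1)) :=
      mul_nonneg (by linarith) (by linarith)
    have e2 : 0 ≤ (p.1 0 - y 0) * (u * (p.2 0 - p.1 0) + v * (p.2 1 - p.1 1)) :=
      mul_nonneg (by linarith) (by linarith)
    have e3 : 0 ≤ v * ((p.1 1 - p.2 1) * (y 0 - p.1 0) + (p.2 0 - p.1 0) * (y 1 - p.1 1)) := by
      linarith
    have hv0 : v = 0 := by
      by_contra hne
      have := mul_neg_of_pos_of_neg (lt_of_le_of_ne hv (Ne.symm hne)) hδ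
      linarith
    subst hv0
    have hy0 : p.1 0 ≤ y 0 := by
      by_contra! hlt
      have := mul_pos (show 0 < u by linarith) (sub_pos.2 hlt)
      linarith
    have : y 0 = p.1 0 := le_antisymm hcon hy0
    rw [this] at hδ
    have := mul_pos (sub_pos.2 h0) (sub_pos.2 hy1)
    linarith
  refine ⟨key, ?_⟩
  by_contra! hcon
  have e1 := mul_pos (sub_pos.2 h1) (sub_pos.2 key)
  have e2 := mul_nonneg (sub_pos.2 h0).le (sub_nonneg.2 hcon)
  linarith

theorem weightedSum_fst_eq_snd (p : (Fin 2 → ℝ) × (Fin 2 → ℝ)) :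
    weightedSum p p.1 = weightedSum p p.2 := by
  unfold weightedSum; ring

/-- A point of `Y` below the chord through `p.1` and `p.2` lies to the upper left of `p.2`. -/
theorem IsSupportedPoint.lt_of_below_right {Y : Set (Fin 2 → ℝ)}
    {p : (Fin 2 → ℝ) × (Fin 2 → ℝ)} (ha : p.1 ∈ Y) (hb : IsSupportedPoint Y p.2)
    (h0 : p.1 0 < p.2 0) (h1 : p.2 1 < p.1 1) {y : Fin 2 → ℝ} (hy : y ∈ Y)
    (h : weightedSum p y < weightedSum p p.1) : y 0 < p.2 0 ∧ p.2 1 < y 1 := by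
  obtain ⟨u, v, hu, hv, huv, hmin⟩ := hb.weights
  have hby := hmin y hy
  have hba := hmin _ ha
  have hδ : (p.1 1 - p.2 1) * (y 0 - p.2 0) + (p.2 0 - p.1 0) * (y 1 - p.2 1) < 0 := by
    rw [weightedSum_fst_eq_snd] at h
    unfold weightedSum at h; linarith
  have key : p.2 1 < y 1 := by
    by_contra! hcon
    have hy0 : p.2 0 < y 0 := by
      by_contra! hcon0
      rw [hb.nondom y hy (fin_two_le hcon0 hcon), weightedSum_fst_eq_snd] at h
      exact lt_irrefl _ h
    have e1 : 0 ≤ (p.1 1 - p.2 1) * (u * (y 0 - p.2 0) + v * (y 1 - p.2 1)) :=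
      mul_nonneg (by linarith) (by linarith)
    have e2 : 0 ≤ (p.2 1 - y 1) * (u * (p.1 0 - p.2 0) + v * (p.1 1 - p.2 1)) :=
      mul_nonneg (by linarith) (by linarith)
    have e3 : 0 ≤ u * ((p.1 1 - p.2 1) * (y 0 - p.2 0) + (p.2 0 - p.1 0) * (y 1 - p.2 1)) := by
      linarith
    have hu0 : u = 0 := by
      by_contra hne
      have := mul_neg_of_pos_of_neg (lt_of_le_of_ne hu (Ne.symm hne)) hδ
      linarith
    subst hu0
    have hy1 : p.2 1 ≤ y 1 := by
      by_contra! hlt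
      have := mul_pos (show 0 < v by linarith) (sub_pos.2 hlt)
      linarith
    have : y 1 = p.2 1 := le_antisymm hcon hy1
    rw [this] at hδ
    have := mul_pos (sub_pos.2 h1) (sub_pos.2 hy0)
    linarith
  refine ⟨?_, key⟩
  by_contra! hcon
  have e1 := mul_pos (sub_pos.2 h0) (sub_pos.2 key)
  have e2 := mul_nonneg (sub_pos.2 h1).le (sub_nonneg.2 hcon)
  linarith

/-- A point on or above a chord is at least a convex combination of the end points. -/
theorem mem_upHull_of_chord_le {T : Set (Fin 2 → ℝ)} {p : (Fin 2 → ℝ) × (Fin 2 → ℝ)}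
    (ha : p.1 ∈ T) (hb : p.2 ∈ T) (h0 : p.1 0 < p.2 0) {y : Fin 2 → ℝ}
    (hya : p.1 0 ≤ y 0) (hyb : p.2 1 ≤ y 1)
    (h : weightedSum p p.1 ≤ weightedSum p y) : y ∈ upHull T := by
  rcases le_total (p.2 0) (y 0) with hc | hc
  · exact ⟨p.2, subset_convexHull ℝ T hb, fin_two_le hc hyb⟩
  · have hd : 0 < p.2 0 - p.1 0 := sub_pos.2 h0
    have hs1 : (p.2 0 - y 0) / (p.2 0 - p.1 0) + (y 0 - p.1 0) / (p.2 0 - p.1 0) = 1 := by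
      field_simp; ring
    -- The point of the chord with the same first coordinate as y.
    refine ⟨((p.2 0 - y 0) / (p.2 0 - p.1 0)) • p.1 + ((y 0 - p.1 0) / (p.2 0 - p.1 0)) • p.2,
      convex_convexHull ℝ T (subset_convexHull ℝ T ha) (subset_convexHull ℝ T hb)
        (div_nonneg (by linarith) hd.le) (div_nonneg (by linarith) hd.le) hs1,
      fin_two_le (le_of_eq ?_) ?_⟩
    · simp only [Pi.add_apply, Pi.smul_apply, smul_eq_mul]
      field_simp
      ring
    · simp only [Pi.add_apply, Pi.smul_apply, smul_eq_mul]
      rw [div_mul_eq_mul_div, div_mul_eq_mul_div, ← add_div, div_le_iff₀ hd]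
      unfold weightedSum at h
      linarith

/-- If `E` generates the lower boundary of `Y`, then every minimizer `c` over `Y` of a weighted sum
with positive weights has a minimizer in `E` weakly on a given side of it. -/
theorem exists_minimizer_side {Y E : Set (Fin 2 → ℝ)} (hEY : E ⊆ Y) (hY : Y ⊆ upHull E)
    {u v : ℝ} (hu : 0 < u) (hv : 0 < v) {c : Fin 2 → ℝ} (hc : c ∈ Y)
    (hmin : ∀ y ∈ Y, u * c 0 + v * c 1 ≤ u * y 0 + v * y 1) (σ : ℝ) :
    ∃ e ∈ E, u * e 0 + v * e 1 = u * c 0 + v * c 1 ∧ σ * c 0 ≤ σ * e 0 := by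
  by_contra! hcon
  -- A lexicographic open half-plane: larger weighted sum, or an equal one and strictly on the wrong
  -- side of c. If the claim fails, C contains E and hence its convex hull. But a hull point z ≤ c
  -- in C must have the same weighted sum, and u, v > 0 then give z 0 = c 0, which C excludes. The
  -- sign of σ selects the side.
  let C : Set (Fin 2 → ℝ) := {z | u * c 0 + v * c 1 < u * z 0 + v * z 1 ∨
    (u * z 0 + v * z 1 = u * c 0 + v * c 1 ∧ σ * z 0 < σ * c 0)}
  have hC : Convex ℝ C := by
    rw [convex_iff_forall_pos]
    intro z hz z' hz' a b ha hb hab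
    have hb' : b = 1 - a := by linarith
    subst hb'
    simp only [C, Set.mem_ofPred_eq, Pi.add_apply, Pi.smul_apply, smul_eq_mul] at hz hz' ⊢
    have hle : u * c 0 + v * c 1 ≤ u * z 0 + v * z 1 := by
      rcases hz with h | h
      · exact h.le
      · exact h.1.ge
    have hle' : u * c 0 + v * c 1 ≤ u * z' 0 + v * z' 1 := by
      rcases hz' with h | h
      · exact h.le
      · exact h.1.ge
    have m1 := mul_nonneg ha.le (sub_nonneg.2 hle)
    have m2 := mul_nonneg hb.le (sub_nonneg.2 hle')
    rcases hz with h | ⟨h, hz0⟩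
    · have := mul_pos ha (sub_pos.2 h)
      left; linarith
    · rcases hz' with h' | ⟨h', hz0'⟩
      · have := mul_pos hb (sub_pos.2 h')
        left; linarith
      · have := mul_pos ha (sub_pos.2 hz0)
        have := mul_pos hb (sub_pos.2 hz0')
        right
        exact ⟨by linear_combination a * h + (1 - a) * h', by linarith⟩
  have hEC : E ⊆ C := by
    intro e he
    rcases (hmin e (hEY he)).lt_or_eq with h | h
    · exact Or.inl h
    · exact Or.inr ⟨h.symm, hcon e he h.symm⟩
  obtain ⟨z, hz, hzc⟩ := hY hc
  have h0 := mul_nonneg hu.le (sub_nonneg.2 (hzc 0))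
  have h1 := mul_nonneg hv.le (sub_nonneg.2 (hzc 1))
  rcases convexHull_min hEC hC hz with h | ⟨h, hz0⟩
  · linarith
  · have hz1 : u * (c 0 - z 0) = 0 := by linarith
    rcases mul_eq_zero.1 hz1 with h' | h'
    · exact hu.ne' h'
    · rw [sub_eq_zero.1 h'] at hz0
      exact lt_irrefl _ hz0

/-! ### Correctness of dichotomic search -/

theorem IsLexMin.mem {n : ℕ} {X : Set (Fin n → ℝ)} {g : (Fin n → ℝ) → Fin 2 → ℝ} {i j : Fin 2}
    {x : Fin n → ℝ} (h : IsLexMin X g i j x) : x ∈ X := by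
  obtain ⟨ε, -, hx⟩ := h
  exact hx.1.1

theorem IsLexMin.le {n : ℕ} {X : Set (Fin n → ℝ)} {g : (Fin n → ℝ) → Fin 2 → ℝ} {i j : Fin 2}
    {x : Fin n → ℝ} (h : IsLexMin X g i j x) {x' : Fin n → ℝ} (hx' : x' ∈ X) :
    g x i ≤ g x' i := by
  obtain ⟨ε, hε, hx⟩ := h
  exact hx.1.2.trans (hε.2 ⟨x', hx', rfl⟩)

theorem IsLexMin.le_of_le {n : ℕ} {X : Set (Fin n → ℝ)} {g : (Fin n → ℝ) → Fin 2 → ℝ}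
    {i j : Fin 2} {x : Fin n → ℝ} (h : IsLexMin X g i j x) {x' : Fin n → ℝ} (hx' : x' ∈ X)
    (hle : g x' i ≤ g x i) : g x j ≤ g x' j := by
  obtain ⟨ε, hε, hx⟩ := h
  exact hx.2 x' ⟨hx', hle.trans hx.1.2⟩

theorem exists_isLexMin {n : ℕ} {X : Set (Fin n → ℝ)} (hX : IsCompact X) (hne : X.Nonempty)
    {g : (Fin n → ℝ) → Fin 2 → ℝ} (hg : ContinuousOn g X) (i j : Fin 2) :
    ∃ x, IsLexMin X g i j x := by
  have hgi : ∀ i, ContinuousOn (fun x => g x i) X := fun i => (continuousOn_pi.1 hg) i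
  obtain ⟨x₀, hx₀, hmin⟩ := hX.exists_isMinOn hne (hgi i)
  have hcl : IsCompact {x | x ∈ X ∧ g x i ≤ g x₀ i} := by
    have := (hgi i).preimage_isClosed_of_isClosed hX.isClosed (isClosed_Iic (a := g x₀ i))
    exact hX.of_isClosed_subset this Set.inter_subset_left
  obtain ⟨x, hx, hxmin⟩ := hcl.exists_isMinOn ⟨x₀, hx₀, le_rfl⟩
    ((hgi j).mono fun x hx => hx.1)
  refine ⟨x, g x₀ i, ⟨⟨x₀, hx₀, rfl⟩, ?_⟩, hx, fun x' hx' => hxmin hx'⟩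
  rintro _ ⟨x', hx', rfl⟩
  exact hmin hx'

theorem IsLexMin.isSupportedPoint_left {n : ℕ} {X : Set (Fin n → ℝ)}
    {g : (Fin n → ℝ) → Fin 2 → ℝ} {x : Fin n → ℝ} (h : IsLexMin X g 0 1 x) :
    IsSupportedPoint (g '' X) (g x) := by
  refine ⟨⟨x, h.mem, rfl⟩, ?_, 1, 0, by norm_num, le_rfl, by norm_num, ?_⟩
  · rintro _ ⟨x', hx', rfl⟩ hle
    exact fin_two_eq ((hle 0).antisymm (h.le hx')) ((hle 1).antisymm (h.le_of_le hx' (hle 0)))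
  · rintro _ ⟨x', hx', rfl⟩
    simpa using h.le hx'

theorem IsLexMin.isSupportedPoint_right {n : ℕ} {X : Set (Fin n → ℝ)}
    {g : (Fin n → ℝ) → Fin 2 → ℝ} {x : Fin n → ℝ} (h : IsLexMin X g 1 0 x) :
    IsSupportedPoint (g '' X) (g x) := by
  refine ⟨⟨x, h.mem, rfl⟩, ?_, 0, 1, le_rfl, by norm_num, by norm_num, ?_⟩
  · rintro _ ⟨x', hx', rfl⟩ hle
    exact fin_two_eq ((hle 0).antisymm (h.le_of_le hx' (hle 1))) ((hle 1).antisymm (h.le hx'))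
  · rintro _ ⟨x', hx', rfl⟩
    simpa using h.le hx'

/-- The invariant of dichotomic search. -/
structure DichInv {n : ℕ} (X : Set (Fin n → ℝ)) (g : (Fin n → ℝ) → Fin 2 → ℝ)
    (s : DichState n) : Prop where
  pending_finite : s.pending.Finite
  sols_finite : s.sols.Finite
  sols_subset : s.sols ⊆ X
  image_sols : g '' s.sols = s.points
  supported : ∀ t ∈ s.points, IsSupportedPoint (g '' X) t
  pair : ∀ p ∈ s.pending, p.1 ∈ s.points ∧ p.2 ∈ s.points ∧ p.1 0 < p.2 0 ∧ p.2 1 < p.1 1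
  cover : ∀ y ∈ g '' X, y ∈ upHull s.points ∨ ∃ p ∈ s.pending,
    weightedSum p y < weightedSum p p.1

theorem DichInit.dichInv {n : ℕ} {X : Set (Fin n → ℝ)} {g : (Fin n → ℝ) → Fin 2 → ℝ}
    {s : DichState n} (h : DichInit X g s) : DichInv X g s := by
  cases h with
  | one xL xR hL hR h =>
    refine ⟨Set.finite_empty, Set.finite_singleton _, by simpa using hL.mem, by simp,
      by simpa using hL.isSupportedPoint_left, by simp, ?_⟩
    rintro _ ⟨x, hx, rfl⟩
    refine Or.inl (upHull_of_le (subset_upHull _ (Set.mem_singleton _)) ?_)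
    exact fin_two_le (hL.le hx) (h ▸ hR.le hx)
  | two xL xR hL hR h =>
    have h0 : g xL 0 < g xR 0 := by
      refine (hL.le hR.mem).lt_of_ne fun h0 => h ?_
      exact fin_two_eq h0 ((hL.le_of_le hR.mem h0.ge).antisymm (hR.le hL.mem))
    have h1 : g xR 1 < g xL 1 := by
      refine (hR.le hL.mem).lt_of_ne fun h1 => h ?_
      exact fin_two_eq ((hL.le hR.mem).antisymm (hR.le_of_le hL.mem h1.ge)) h1.symm
    refine ⟨Set.finite_singleton _, by simp, ?_, by simp [Set.image_pair], ?_, ?_, ?_⟩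
    · rintro x (rfl | rfl)
      · exact hL.mem
      · exact hR.mem
    · rintro t (rfl | rfl)
      · exact hL.isSupportedPoint_left
      · exact hR.isSupportedPoint_right
    · rintro p rfl
      exact ⟨by simp, by simp, h0, h1⟩
    · rintro _ ⟨x, hx, rfl⟩
      by_cases hlt : weightedSum (g xL, g xR) (g x) < weightedSum (g xL, g xR) (g xL)
      · exact Or.inr ⟨_, rfl, hlt⟩
      · exact Or.inl (mem_upHull_of_chord_le (p := (g xL, g xR)) (by simp) (by simp) h0
          (hL.le hx) (hR.le hx) (not_lt.1 hlt))

/-- The new point found by an improving step is supported. -/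
theorem DichInv.isSupportedPoint_new {n : ℕ} {X : Set (Fin n → ℝ)} {g : (Fin n → ℝ) → Fin 2 → ℝ}
    {s : DichState n} (hs : DichInv X g s) {p : (Fin 2 → ℝ) × (Fin 2 → ℝ)} (hp : p ∈ s.pending)
    {x : Fin n → ℝ} (hx : x ∈ argminSet (fun x' => weightedSum p (g x')) X) :
    IsSupportedPoint (g '' X) (g x) := by
  obtain ⟨-, -, h0, h1⟩ := hs.pair p hp
  have hmin : ∀ y ∈ g '' X, weightedSum p (g x) ≤ weightedSum p y := by
    rintro _ ⟨x', hx', rfl⟩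
    exact hx.2 x' hx'
  refine ⟨⟨x, hx.1, rfl⟩, fun y hy hle => ?_, p.1 1 - p.2 1, p.2 0 - p.1 0, by linarith,
    by linarith, by linarith, hmin⟩
  have h := hmin y hy
  unfold weightedSum at h
  have e0 := mul_nonneg (sub_pos.2 h1).le (sub_nonneg.2 (hle 0))
  have e1 := mul_nonneg (sub_pos.2 h0).le (sub_nonneg.2 (hle 1))
  have z0 : (p.1 1 - p.2 1) * (g x 0 - y 0) = 0 := by linarith
  have z1 : (p.2 0 - p.1 0) * (g x 1 - y 1) = 0 := by linarith
  rcases mul_eq_zero.1 z0 with z0 | z0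
  · linarith
  rcases mul_eq_zero.1 z1 with z1 | z1
  · linarith
  exact fin_two_eq (by linarith) (by linarith)

theorem DichInv.below_bounds {n : ℕ} {X : Set (Fin n → ℝ)} {g : (Fin n → ℝ) → Fin 2 → ℝ}
    {s : DichState n} (hs : DichInv X g s) {p : (Fin 2 → ℝ) × (Fin 2 → ℝ)} (hp : p ∈ s.pending)
    {y : Fin 2 → ℝ} (hy : y ∈ g '' X) (h : weightedSum p y < weightedSum p p.1) :
    (p.1 0 < y 0 ∧ y 1 < p.1 1) ∧ (y 0 < p.2 0 ∧ p.2 1 < y 1) := by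
  obtain ⟨ha, hb, h0, h1⟩ := hs.pair p hp
  exact ⟨(hs.supported _ ha).lt_of_below_left (hs.supported _ hb).mem h0 h1 hy h,
    (hs.supported _ hb).lt_of_below_right (hs.supported _ ha).mem h0 h1 hy h⟩

/-- Only the covering property needs geometry. A point below the split chord but below neither new
chord is covered by the chord on its own side of the new point. A discarded chord has no image point
below it. -/
theorem DichInv.step {n : ℕ} {X : Set (Fin n → ℝ)} {g : (Fin n → ℝ) → Fin 2 → ℝ}
    {s t : DichState n} (hs : DichInv X g s) (h : DichStep X g s t) : DichInv X g t := by
  cases h with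
  | improve p hp x hx h =>
    have hxY : g x ∈ g '' X := ⟨x, hx.1, rfl⟩
    obtain ⟨⟨l0, l1⟩, r0, r1⟩ := hs.below_bounds hp hxY h
    obtain ⟨ha, hb, h0, h1⟩ := hs.pair p hp
    refine ⟨(hs.pending_finite.subset Set.sdiff_subset).union (by simp),
      hs.sols_finite.insert x, Set.insert_subset hx.1 hs.sols_subset, ?_, ?_, ?_, ?_⟩
    · simp only [Set.image_insert_eq, hs.image_sols]
    · rintro t (rfl | ht)
      · exact hs.isSupportedPoint_new hp hx
      · exact hs.supported t ht
    · rintro q (hq | rfl | rfl)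
      · obtain ⟨h2, h3, h4⟩ := hs.pair q hq.1
        exact ⟨Or.inr h2, Or.inr h3, h4⟩
      · exact ⟨Or.inr ha, Or.inl rfl, l0, l1⟩
      · exact ⟨Or.inl rfl, Or.inr hb, r0, r1⟩
    · intro y hy
      rcases hs.cover y hy with hc | ⟨q, hq, hlt⟩
      · exact Or.inl (upHull_mono (Set.subset_insert _ _) hc)
      by_cases hqp : q = p
      · subst hqp
        obtain ⟨⟨yl0, yl1⟩, yr0, yr1⟩ := hs.below_bounds hq hy hlt
        by_cases hl : weightedSum (q.1, g x) y < weightedSum (q.1, g x) q.1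
        · exact Or.inr ⟨(q.1, g x), Or.inr (Or.inl rfl), hl⟩
        by_cases hr : weightedSum (g x, q.2) y < weightedSum (g x, q.2) (g x)
        · exact Or.inr ⟨(g x, q.2), Or.inr (Or.inr rfl), hr⟩
        left
        have hmin : weightedSum q (g x) ≤ weightedSum q y := by
          obtain ⟨x', hx', rfl⟩ := hy
          exact hx.2 x' hx'
        rcases le_total (y 0) (g x 0) with hyc | hyc
        · refine mem_upHull_of_chord_le (p := (q.1, g x)) (Or.inr ha) (Or.inl rfl) l0 yl0.le ?_
            (not_lt.1 hl)
          -- A point weakly left of the new point and strictly lower would have a smaller weighted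
          -- sum.
          by_contra! hcon
          have hcon' : y 1 < g x 1 := hcon
          unfold weightedSum at hmin
          have e0 := mul_nonneg (sub_pos.2 h1).le (sub_nonneg.2 hyc)
          have e1 := mul_pos (sub_pos.2 h0) (sub_pos.2 hcon')
          linarith
        · exact mem_upHull_of_chord_le (p := (g x, q.2)) (Or.inl rfl) (Or.inr hb) r0 hyc yr1.le
            (not_lt.1 hr)
      · exact Or.inr ⟨q, Or.inl ⟨hq, hqp⟩, hlt⟩
  | discard p hp x hx h =>
    refine ⟨hs.pending_finite.subset Set.sdiff_subset, hs.sols_finite, hs.sols_subset,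
      hs.image_sols, hs.supported, fun q hq => hs.pair q hq.1, fun y hy => ?_⟩
    rcases hs.cover y hy with hc | ⟨q, hq, hlt⟩
    · exact Or.inl hc
    · refine Or.inr ⟨q, ⟨hq, ?_⟩, hlt⟩
      rintro rfl
      obtain ⟨x', hx', rfl⟩ := hy
      exact h ((hx.2 x' hx').trans_lt hlt)

theorem DichInv.exists_step {n : ℕ} {X : Set (Fin n → ℝ)} (hX : IsCompact X) (hne : X.Nonempty)
    {g : (Fin n → ℝ) → Fin 2 → ℝ} (hg : ContinuousOn g X) {s : DichState n}
    (hs : s.pending.Nonempty) : ∃ t, DichStep X g s t := by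
  obtain ⟨p, hp⟩ := hs
  have hgi : ∀ i, ContinuousOn (fun x => g x i) X := fun i => (continuousOn_pi.1 hg) i
  have hc : ContinuousOn (fun x => weightedSum p (g x)) X :=
    (continuousOn_const.mul (hgi 0)).add (continuousOn_const.mul (hgi 1))
  obtain ⟨x, hx, hmin⟩ := hX.exists_isMinOn hne hc
  by_cases h : weightedSum p (g x) < weightedSum p p.1
  · exact ⟨_, .improve s p hp x ⟨hx, fun x' hx' => hmin hx'⟩ h⟩
  · exact ⟨_, .discard s p hp x ⟨hx, fun x' hx' => hmin hx'⟩ h⟩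

theorem exists_dichInit {n : ℕ} {X : Set (Fin n → ℝ)} (hX : IsCompact X) (hne : X.Nonempty)
    {g : (Fin n → ℝ) → Fin 2 → ℝ} (hg : ContinuousOn g X) : ∃ s, DichInit X g s := by
  obtain ⟨xL, hL⟩ := exists_isLexMin hX hne hg 0 1
  obtain ⟨xR, hR⟩ := exists_isLexMin hX hne hg 1 0
  by_cases h : g xL = g xR
  · exact ⟨_, .one xL xR hL hR h⟩
  · exact ⟨_, .two xL xR hL hR h⟩

theorem DichInv.represents {n : ℕ} {X : Set (Fin n → ℝ)} {g : (Fin n → ℝ) → Fin 2 → ℝ}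
    {s : DichState n} (hs : DichInv X g s) (h : s.pending = ∅) :
    Represents (g '' X) s.points := by
  refine ⟨fun t ht => (hs.supported t ht).mem_nondominated, fun y hy => ?_⟩
  rcases hs.cover y hy with hc | ⟨p, hp, -⟩
  · exact hc
  · rw [h] at hp
    exact hp.elim

theorem DichState.cleanPoints_eq {n : ℕ} (s : DichState n) :
    s.cleanPoints = irredundant s.points := rfl

theorem DichInv.image_cleanSols {n : ℕ} {X : Set (Fin n → ℝ)} {g : (Fin n → ℝ) → Fin 2 → ℝ}
    {s : DichState n} (hs : DichInv X g s) : g '' s.cleanSols g = s.cleanPoints := by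
  ext y
  constructor
  · rintro ⟨x, hx, rfl⟩
    exact hx.2
  · intro hy
    have h := hy.1
    rw [← hs.image_sols] at h
    obtain ⟨x, hx, rfl⟩ := h
    exact ⟨x, ⟨hx, hy⟩, rfl⟩

/-! ### Termination of dichotomic search -/

/-- The number of points of `E` strictly between the end points of `p`. -/
noncomputable def countBetween (E : Finset (Fin 2 → ℝ)) (p : (Fin 2 → ℝ) × (Fin 2 → ℝ)) : ℕ := by
  classical exact (E.filter fun e => p.1 0 < e 0 ∧ e 0 < p.2 0).card

theorem countBetween_lt {E : Finset (Fin 2 → ℝ)} {p q : (Fin 2 → ℝ) × (Fin 2 → ℝ)}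
    (h0 : p.1 0 ≤ q.1 0) (h1 : q.2 0 ≤ p.2 0) {e : Fin 2 → ℝ} (he : e ∈ E) (hp0 : p.1 0 < e 0)
    (hp1 : e 0 < p.2 0) (hq : q.1 0 < e 0 → q.2 0 ≤ e 0) :
    countBetween E q < countBetween E p := by
  classical
  refine Finset.card_lt_card (Finset.ssubset_iff_of_subset ?_ |>.2 ⟨e, ?_, ?_⟩)
  · intro a ha
    simp only [Finset.mem_filter] at ha ⊢
    exact ⟨ha.1, by linarith, by linarith⟩
  · simp [he, hp0, hp1]
  · simp only [Finset.mem_filter, not_and, not_lt]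
    exact fun _ => hq

/-- Dichotomic search terminates if finitely many points generate the lower boundary. -/
theorem DichInv.acc {n : ℕ} {X : Set (Fin n → ℝ)} {g : (Fin n → ℝ) → Fin 2 → ℝ}
    (E : Finset (Fin 2 → ℝ)) (hEY : (E : Set (Fin 2 → ℝ)) ⊆ g '' X) (hY : g '' X ⊆ upHull E)
    {s : DichState n} (hs : DichInv X g s) : Acc (fun t s => DichStep X g s t) s := by
  classical
  -- The potential is the sum of 3^c over pending pairs, c counting the points of E between the
  -- ends. Splitting replaces 3^c by at most 2 · 3^(c-1), and discarding removes a positive term.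
  suffices H : ∀ N : ℕ, ∀ (s : DichState n) (F : Finset ((Fin 2 → ℝ) × (Fin 2 → ℝ))),
      DichInv X g s → s.pending = F → ∑ p ∈ F, 3 ^ countBetween E p = N →
      Acc (fun t s => DichStep X g s t) s from
    H _ s hs.pending_finite.toFinset hs (by simp) rfl
  intro N
  induction N using Nat.strong_induction_on with
  | _ N ih =>
    intro s F hs hF hN
    refine Acc.intro _ fun t hst => ?_
    have ht := hs.step hst
    cases hst with
    | improve p hp x hx h =>
      have hpF : p ∈ F := by rw [hF] at hp; exact hp
      refine ih _ ?_ _ (F.erase p ∪ {(p.1, g x), (g x, p.2)}) ht (by simp [hF]) rfl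
      have hmin : ∀ y ∈ g '' X, (p.1 1 - p.2 1) * g x 0 + (p.2 0 - p.1 0) * g x 1 ≤
          (p.1 1 - p.2 1) * y 0 + (p.2 0 - p.1 0) * y 1 := by
        rintro _ ⟨x', hx', rfl⟩
        exact hx.2 x' hx'
      obtain ⟨-, -, h0, h1⟩ := hs.pair p hp
      obtain ⟨⟨l0, -⟩, r0, -⟩ := hs.below_bounds hp ⟨x, hx.1, rfl⟩ h
      have hface : ∀ e ∈ E, (p.1 1 - p.2 1) * e 0 + (p.2 0 - p.1 0) * e 1 =
          (p.1 1 - p.2 1) * g x 0 + (p.2 0 - p.1 0) * g x 1 → p.1 0 < e 0 ∧ e 0 < p.2 0 := by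
        intro e he heq
        have hlt : weightedSum p e < weightedSum p p.1 := by
          refine lt_of_eq_of_lt ?_ h
          exact heq
        obtain ⟨⟨e0, -⟩, e1, -⟩ := hs.below_bounds hp (hEY he) hlt
        exact ⟨e0, e1⟩
      -- The new point need not be in E, but some minimizer e in E lies weakly to its right. It is
      -- counted for p and not for the left half; the choice σ = -1 serves the right half.
      have hl : countBetween E (p.1, g x) < countBetween E p := by
        obtain ⟨e, he, heq, hle⟩ := exists_minimizer_side hEY hY (sub_pos.2 h1) (sub_pos.2 h0)
          ⟨x, hx.1, rfl⟩ hmin 1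
        obtain ⟨e0, e1⟩ := hface e he heq
        exact countBetween_lt le_rfl r0.le he e0 e1 fun _ => by linarith
      have hr : countBetween E (g x, p.2) < countBetween E p := by
        obtain ⟨e, he, heq, hle⟩ := exists_minimizer_side hEY hY (sub_pos.2 h1) (sub_pos.2 h0)
          ⟨x, hx.1, rfl⟩ hmin (-1)
        obtain ⟨e0, e1⟩ := hface e he heq
        exact countBetween_lt l0.le le_rfl he e0 e1 fun hlt => by
          change g x 0 < e 0 at hlt
          linarith
      -- Only an inequality, since a new pair may coincide with a pending one or with the other new
      -- pair.
      have b1 : ∑ q ∈ F.erase p ∪ {(p.1, g x), (g x, p.2)}, 3 ^ countBetween E q ≤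
          ∑ q ∈ F.erase p, 3 ^ countBetween E q +
            (3 ^ countBetween E (p.1, g x) + 3 ^ countBetween E (g x, p.2)) := by
        rw [Finset.union_insert, Finset.union_singleton]
        calc _ ≤ 3 ^ countBetween E (p.1, g x) +
              ∑ q ∈ insert (g x, p.2) (F.erase p), 3 ^ countBetween E q := by
              by_cases hm : (p.1, g x) ∈ insert (g x, p.2) (F.erase p)
              · rw [Finset.insert_eq_of_mem hm]; exact Nat.le_add_left _ _
              · rw [Finset.sum_insert hm]
          _ ≤ 3 ^ countBetween E (p.1, g x) + (3 ^ countBetween E (g x, p.2) +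
              ∑ q ∈ F.erase p, 3 ^ countBetween E q) := by
              gcongr
              by_cases hm : (g x, p.2) ∈ F.erase p
              · rw [Finset.insert_eq_of_mem hm]; exact Nat.le_add_left _ _
              · rw [Finset.sum_insert hm]
          _ = _ := by ring
      have b2 := Finset.sum_erase_add F (fun q => 3 ^ countBetween E q) hpF
      have b3 : 3 * 3 ^ countBetween E (p.1, g x) ≤ 3 ^ countBetween E p := by
        rw [← pow_succ']; exact Nat.pow_le_pow_right (by norm_num) hl
      have b4 : 3 * 3 ^ countBetween E (g x, p.2) ≤ 3 ^ countBetween E p := by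
        rw [← pow_succ']; exact Nat.pow_le_pow_right (by norm_num) hr
      have b5 : 0 < 3 ^ countBetween E p := by positivity
      omega
    | discard p hp x hx h =>
      have hpF : p ∈ F := by rw [hF] at hp; exact hp
      refine ih _ ?_ _ (F.erase p) ht (by simp [hF]) rfl
      have b2 := Finset.sum_erase_add F (fun q => 3 ^ countBetween E q) hpF
      have b5 : 0 < 3 ^ countBetween E p := by positivity
      omega

/-! ### Polyhedra and finite generation of the lower boundary -/

/-- A set that is the solution set of finitely many weak linear inequalities. -/
def IsHPolyhedron {F : Type*} [AddCommGroup F] [Module ℝ F] (K : Set F) : Prop :=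
  ∃ L : Set ((F →ₗ[ℝ] ℝ) × ℝ), L.Finite ∧ K = {x | ∀ p ∈ L, p.1 x ≤ p.2}

section Polyhedron

variable {F : Type*} [AddCommGroup F] [Module ℝ F]

theorem isHPolyhedron_halfspace (l : F →ₗ[ℝ] ℝ) (b : ℝ) : IsHPolyhedron {x | l x ≤ b} :=
  ⟨{(l, b)}, Set.finite_singleton _, by simp⟩

theorem IsHPolyhedron.inter {K K' : Set F} (h : IsHPolyhedron K) (h' : IsHPolyhedron K') :
    IsHPolyhedron (K ∩ K') := by
  obtain ⟨L, hL, rfl⟩ := h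
  obtain ⟨L', hL', rfl⟩ := h'
  refine ⟨L ∪ L', hL.union hL', ?_⟩
  ext x
  constructor
  · rintro ⟨h1, h2⟩ p (hp | hp)
    · exact h1 p hp
    · exact h2 p hp
  · exact fun h => ⟨fun p hp => h p (Or.inl hp), fun p hp => h p (Or.inr hp)⟩

theorem isHPolyhedron_forall {ι : Type*} [Finite ι] {Q : ι → F → Prop}
    (h : ∀ i, IsHPolyhedron {x | Q i x}) : IsHPolyhedron {x | ∀ i, Q i x} := by
  choose L hL hK using h
  refine ⟨⋃ i, L i, Set.finite_iUnion hL, ?_⟩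
  ext x
  have hx : ∀ i, Q i x ↔ ∀ p ∈ L i, p.1 x ≤ p.2 := fun i => Set.ext_iff.1 (hK i) x
  constructor
  · intro h p hp
    obtain ⟨i, hi⟩ := Set.mem_iUnion.1 hp
    exact (hx i).1 (h i) p hi
  · exact fun h i => (hx i).2 fun p hp => h p (Set.mem_iUnion.2 ⟨i, hp⟩)

theorem IsHPolyhedron.preimage {F' : Type*} [AddCommGroup F'] [Module ℝ F'] {K : Set F}
    (h : IsHPolyhedron K) (l : F' →ₗ[ℝ] F) : IsHPolyhedron (l ⁻¹' K) := by
  obtain ⟨L, hL, rfl⟩ := h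
  refine ⟨(fun p => (p.1 ∘ₗ l, p.2)) '' L, hL.image _, ?_⟩
  ext x
  constructor
  · rintro h _ ⟨p, hp, rfl⟩
    exact h p hp
  · exact fun h p hp => h _ ⟨p, hp, rfl⟩

theorem IsHPolyhedron.convex {K : Set F} (h : IsHPolyhedron K) : Convex ℝ K := by
  obtain ⟨L, -, rfl⟩ := h
  intro x hx y hy a b ha hb hab p hp
  rw [map_add, map_smul, map_smul, smul_eq_mul, smul_eq_mul]
  have h1 := mul_le_mul_of_nonneg_left (hx p hp) ha
  have h2 := mul_le_mul_of_nonneg_left (hy p hp) hb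
  calc _ ≤ a * p.2 + b * p.2 := add_le_add h1 h2
    _ = p.2 := by rw [← add_mul, hab, one_mul]

theorem IsHPolyhedron.isClosed [TopologicalSpace F] [IsTopologicalAddGroup F]
    [ContinuousSMul ℝ F] [T2Space F] [FiniteDimensional ℝ F] {K : Set F} (h : IsHPolyhedron K) :
    IsClosed K := by
  obtain ⟨L, -, rfl⟩ := h
  have : {x | ∀ p ∈ L, p.1 x ≤ p.2} = ⋂ p ∈ L, {x | p.1 x ≤ p.2} := by ext; simp
  rw [this]
  exact isClosed_biInter fun p _ =>
    isClosed_le (LinearMap.continuous_of_finiteDimensional p.1) continuous_const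

/-- An extreme point of a polyhedron is determined by the constraints that it satisfies with
equality. -/
theorem IsHPolyhedron.finite_extremePoints {K : Set F} (h : IsHPolyhedron K) :
    (Set.extremePoints ℝ K).Finite := by
  obtain ⟨L, hL, rfl⟩ := h
  have hfin : {S | S ⊆ L}.Finite := hL.finite_subsets
  refine Set.Finite.of_finite_image (f := fun x => {p | p ∈ L ∧ p.1 x = p.2})
    (hfin.subset ?_) ?_
  · rintro _ ⟨x, -, rfl⟩ p hp
    exact hp.1
  intro x hx y hy hxy
  -- If x and y have the same tight constraints, the segment from y to x can be prolonged slightly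
  -- beyond x: slack constraints survive by continuity, tight ones are constant along the line.
  -- Extremality of x then forces y = x.
  have hev : ∀ᶠ ε : ℝ in nhdsWithin 0 (Set.Ioi 0),
      ∀ p ∈ L, p.1 (x + ε • (x - y)) ≤ p.2 := by
    rw [Filter.eventually_all_finite hL]
    intro p hp
    rcases (hx.1 p hp).lt_or_eq with hlt | heq
    · have hc : Continuous fun ε : ℝ => p.1 x + ε * p.1 (x - y) := by fun_prop
      have h0 : Filter.Tendsto (fun ε : ℝ => p.1 x + ε * p.1 (x - y)) (nhdsWithin 0 (Set.Ioi 0))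
          (nhds (p.1 x)) := by
        have := hc.tendsto 0
        simp only [zero_mul, add_zero] at this
        exact this.mono_left nhdsWithin_le_nhds
      filter_upwards [h0.eventually (gt_mem_nhds hlt)] with ε hε
      rw [map_add, map_smul, smul_eq_mul]
      exact hε.le
    · have hy' : p.1 y = p.2 := by
        have : p ∈ {p | p ∈ L ∧ p.1 y = p.2} := (Set.ext_iff.1 hxy p).1 ⟨hp, heq⟩
        exact this.2
      refine Filter.Eventually.of_forall fun ε => ?_
      rw [map_add, map_smul, map_sub, heq, hy']
      simp
  obtain ⟨ε, hε, hpos⟩ := (hev.and self_mem_nhdsWithin).exists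
  have hpos : 0 < ε := hpos
  refine (hx.2 hy.1 hε ⟨ε / (1 + ε), 1 / (1 + ε), by positivity, by positivity, ?_, ?_⟩).symm
  · field_simp; ring
  · rw [smul_add, smul_smul, smul_sub]
    have : 1 / (1 + ε) * ε = ε / (1 + ε) := by ring
    rw [this]
    have h1 : (1 / (1 + ε)) • x + (ε / (1 + ε)) • x = x := by
      rw [← add_smul]
      have : 1 / (1 + ε) + ε / (1 + ε) = 1 := by field_simp
      rw [this, one_smul]
    calc _ = (1 / (1 + ε)) • x + (ε / (1 + ε)) • x := by abel
      _ = x := h1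

end Polyhedron

/-- Krein–Milman, where the closure is superfluous because the hull of a finite set is closed. -/
theorem IsCompact.convexHull_extremePoints {F : Type*} [NormedAddCommGroup F] [NormedSpace ℝ F]
    {K : Set F} (hK : IsCompact K) (hc : Convex ℝ K) (hfin : (Set.extremePoints ℝ K).Finite) :
    convexHull ℝ (Set.extremePoints ℝ K) = K := by
  rw [← (hfin.isClosed_convexHull ℝ).closure_eq]
  exact closure_convexHull_extremePoints hK hc

theorem IsPolytope.isHPolyhedron {d : ℕ} {P : Set (Fin d → ℝ)} (h : IsPolytope P) :
    IsHPolyhedron P := by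
  obtain ⟨⟨r, A, b, rfl⟩, -⟩ := h
  exact isHPolyhedron_forall fun i =>
    isHPolyhedron_halfspace ((LinearMap.proj i).comp A.mulVecLin) (b i)

theorem IsPolytope.isCompact {d : ℕ} {P : Set (Fin d → ℝ)} (h : IsPolytope P) : IsCompact P :=
  Metric.isCompact_of_isClosed_isBounded h.isHPolyhedron.isClosed h.2

/-- The mixed-integer points of a polytope are a finite union of polytopes. -/
theorem IsPolytope.mixedIntegerPart_eq_biUnion {n : ℕ} {P : Set (Fin n → ℝ)} (hP : IsPolytope P)
    (k : ℕ) : ∃ (Z : Set (Fin n → ℤ)) (K : (Fin n → ℤ) → Set (Fin n → ℝ)), Z.Finite ∧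
      (∀ z, IsHPolyhedron (K z) ∧ IsCompact (K z)) ∧ mixedIntegerPart P k = ⋃ z ∈ Z, K z := by
  obtain ⟨B, hB⟩ := hP.2.exists_norm_le
  let K : (Fin n → ℤ) → Set (Fin n → ℝ) := fun z =>
    P ∩ ({x | ∀ j : {j : Fin n // (j : ℕ) < k}, x j ≤ z j} ∩
      {x | ∀ j : {j : Fin n // (j : ℕ) < k}, - x j ≤ - z j})
  have hK : ∀ z, IsHPolyhedron (K z) := by
    refine fun z => hP.isHPolyhedron.inter (IsHPolyhedron.inter ?_ ?_)
    · exact isHPolyhedron_forall fun j : {j : Fin n // (j : ℕ) < k} =>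
        isHPolyhedron_halfspace (F := Fin n → ℝ) (LinearMap.proj j.1) _
    · exact isHPolyhedron_forall fun j : {j : Fin n // (j : ℕ) < k} =>
        isHPolyhedron_halfspace (F := Fin n → ℝ) (-LinearMap.proj j.1) _
  refine ⟨Set.Icc (fun _ => -⌈B⌉) (fun _ => ⌈B⌉), K, Set.finite_Icc _ _,
    fun z => ⟨hK z, hP.isCompact.of_isClosed_subset (hK z).isClosed Set.inter_subset_left⟩, ?_⟩
  ext x
  simp only [Set.mem_iUnion, exists_prop]
  constructor
  · rintro ⟨hx, hint⟩
    choose! z hz using hint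
    have hxB : ∀ j, |x j| ≤ ⌈B⌉ := fun j =>
      (norm_le_pi_norm x j).trans ((hB x hx).trans (Int.le_ceil B))
    have hB0 : (0 : ℤ) ≤ ⌈B⌉ := Int.ceil_nonneg ((norm_nonneg x).trans (hB x hx))
    -- Entries of z from index k on do not affect `K z`; the default 0 merely keeps z in the finite
    -- box.
    refine ⟨fun j => if (j : ℕ) < k then z j else 0, ⟨fun j => ?_, fun j => ?_⟩, hx, ?_, ?_⟩
    · dsimp only
      split_ifs with hj
      · have := (abs_le.1 (hxB j)).1
        rw [hz j hj] at this
        exact_mod_cast this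
      · linarith
    · dsimp only
      split_ifs with hj
      · have := (abs_le.1 (hxB j)).2
        rw [hz j hj] at this
        exact_mod_cast this
      · exact hB0
    · rintro ⟨j, hj⟩
      simp [hj, hz j hj]
    · rintro ⟨j, hj⟩
      simp [hj, hz j hj]
  · rintro ⟨z, -, hx, h1, h2⟩
    exact ⟨hx, fun j hj => ⟨z j, le_antisymm (h1 ⟨j, hj⟩) (neg_le_neg_iff.1 (h2 ⟨j, hj⟩))⟩⟩

theorem IsPolytope.isCompact_mixedIntegerPart {n : ℕ} {P : Set (Fin n → ℝ)} (hP : IsPolytope P)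
    (k : ℕ) : IsCompact (mixedIntegerPart P k) := by
  obtain ⟨Z, K, hZ, hK, h⟩ := hP.mixedIntegerPart_eq_biUnion k
  rw [h]
  exact hZ.isCompact_biUnion fun z _ => (hK z).2

/-- The lower boundary of the image of a polytope under a vector of maxima of finitely many linear
functions is generated by finitely many points of the image. -/
theorem exists_finite_generators_of_isHPolyhedron {n : ℕ} {Ξ : Type*} [Finite Ξ]
    {K : Set (Fin n → ℝ)} (hK : IsHPolyhedron K) (hKc : IsCompact K)
    {g : (Fin n → ℝ) → Fin 2 → ℝ} (l : Fin 2 → Ξ → (Fin n → ℝ) →ₗ[ℝ] ℝ)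
    (hg : ∀ x ∈ K, ∀ i r, g x i ≤ r ↔ ∀ ξ, l i ξ x ≤ r) (hgc : ContinuousOn g K) :
    ∃ E : Set (Fin 2 → ℝ), E.Finite ∧ E ⊆ g '' K ∧ g '' K ⊆ upHull E := by
  have hbd := (hKc.image_of_continuousOn hgc).isBounded
  obtain ⟨m, hm⟩ := hbd.bddBelow
  obtain ⟨M, hM⟩ := hbd.bddAbove
  -- The epigraph of g over K, cut off at M to make it compact. Writing (x, g x) as a convex
  -- combination of extreme points (xₑ, tₑ) and using g xₑ ≤ tₑ shows that the values g xₑ generate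
  -- g x.
  let Q : Set ((Fin n → ℝ) × (Fin 2 → ℝ)) :=
    (LinearMap.fst ℝ _ _ ⁻¹' K) ∩ ({q | ∀ i ξ, l i ξ q.1 - q.2 i ≤ 0} ∩ {q | ∀ i, q.2 i ≤ M i})
  have hQ : IsHPolyhedron Q := by
    refine (hK.preimage _).inter (IsHPolyhedron.inter ?_ ?_)
    · exact isHPolyhedron_forall fun i => isHPolyhedron_forall fun ξ =>
        isHPolyhedron_halfspace (F := (Fin n → ℝ) × (Fin 2 → ℝ))
          ((l i ξ).comp (LinearMap.fst ℝ _ _) -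
            (LinearMap.proj (φ := fun _ : Fin 2 => ℝ) i).comp (LinearMap.snd ℝ _ _)) 0
    · exact isHPolyhedron_forall fun i =>
        isHPolyhedron_halfspace (F := (Fin n → ℝ) × (Fin 2 → ℝ))
          ((LinearMap.proj (φ := fun _ : Fin 2 => ℝ) i).comp (LinearMap.snd ℝ _ _)) (M i)
  have hQg : ∀ q ∈ Q, q.1 ∈ K ∧ g q.1 ≤ q.2 := fun q hq =>
    ⟨hq.1, fun i => (hg q.1 hq.1 i _).2 fun ξ => sub_nonpos.1 (hq.2.1 i ξ)⟩
  have hQc : IsCompact Q := by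
    refine (hKc.prod (isCompact_Icc (a := m) (b := M))).of_isClosed_subset hQ.isClosed ?_
    exact fun q hq => ⟨hq.1, (hm ⟨q.1, hq.1, rfl⟩).trans (hQg q hq).2, hq.2.2⟩
  have hfin := hQ.finite_extremePoints
  have hconv := hQc.convexHull_extremePoints hQ.convex hfin
  refine ⟨(fun q => g q.1) '' Set.extremePoints ℝ Q, hfin.image _, ?_, ?_⟩
  · rintro _ ⟨q, hq, rfl⟩
    exact ⟨q.1, (hQg q hq.1).1, rfl⟩
  · rintro _ ⟨x, hx, rfl⟩
    have hxQ : (x, g x) ∈ Q := ⟨hx, fun i ξ => sub_nonpos.2 ((hg x hx i _).1 le_rfl ξ),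
      hM ⟨x, hx, rfl⟩⟩
    rw [← hconv] at hxQ
    have hsub : Set.extremePoints ℝ Q ⊆ LinearMap.snd ℝ (Fin n → ℝ) (Fin 2 → ℝ) ⁻¹'
        upHull ((fun q => g q.1) '' Set.extremePoints ℝ Q) := fun q hq =>
      upHull_of_le (subset_upHull _ ⟨q, hq, rfl⟩) (hQg q hq.1).2
    exact convexHull_min hsub ((convex_upHull _).linear_preimage _) hxQ

/-! ### Worst-case objectives for finite scenario sets -/

section RobustObj

variable {n m : ℕ} {f : Fin 2 → (Fin n → ℝ) → (Fin m → ℝ) → ℝ} {V : Set (Fin m → ℝ)}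

theorem robustObj_le_iff (hV : V.Finite) (hne : V.Nonempty) {x : Fin n → ℝ} {i : Fin 2} {r : ℝ} :
    robustObj f V x i ≤ r ↔ ∀ ξ ∈ V, f i x ξ ≤ r := by
  unfold robustObj
  rw [csSup_le_iff (hV.image _).bddAbove (hne.image _)]
  simp

theorem continuousOn_robustObj {X : Set (Fin n → ℝ)} (hV : V.Finite) (hne : V.Nonempty)
    (hlin : ∀ i, ∀ ξ ∈ V, ∃ c : Fin n → ℝ, ∀ x ∈ X, f i x ξ = c ⬝ᵥ x) :
    ContinuousOn (robustObj f V) X := by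
  refine continuousOn_pi.2 fun i => ?_
  have hne' : hV.toFinset.Nonempty := (Set.Finite.toFinset_nonempty hV).2 hne
  have hc : ContinuousOn (fun x => hV.toFinset.sup' hne' fun ξ => f i x ξ) X := by
    refine ContinuousOn.finset_sup'_apply (f := fun ξ x => f i x ξ) hne' fun ξ hξ => ?_
    obtain ⟨c, hc⟩ := hlin i ξ ((Set.Finite.mem_toFinset hV).1 hξ)
    have h1 : Continuous fun x : Fin n → ℝ => c ⬝ᵥ x :=
      LinearMap.continuous_of_finiteDimensional (dotProductBilin ℝ ℝ c)
    exact h1.continuousOn.congr hc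
  refine hc.congr fun x _ => eq_of_forall_ge_iff fun r => ?_
  rw [robustObj_le_iff hV hne, Finset.sup'_le_iff]
  simp

theorem exists_finite_generators {P : Set (Fin n → ℝ)} (hP : IsPolytope P) (k : ℕ)
    (hV : V.Finite) (hne : V.Nonempty)
    (hlin : ∀ i, ∀ ξ ∈ V, ∃ c : Fin n → ℝ, ∀ x ∈ mixedIntegerPart P k, f i x ξ = c ⬝ᵥ x) :
    ∃ E : Set (Fin 2 → ℝ), E.Finite ∧ E ⊆ robustObj f V '' mixedIntegerPart P k ∧
      robustObj f V '' mixedIntegerPart P k ⊆ upHull E := by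
  have hcont := continuousOn_robustObj hV hne hlin
  choose! c hc using hlin
  obtain ⟨Z, K, hZ, hK, hX⟩ := hP.mixedIntegerPart_eq_biUnion k
  have hKX : ∀ z ∈ Z, K z ⊆ mixedIntegerPart P k := fun z hz => by
    rw [hX]; exact Set.subset_biUnion_of_mem hz
  have := hV.to_subtype
  have hE : ∀ z ∈ Z, ∃ E : Set (Fin 2 → ℝ), E.Finite ∧ E ⊆ robustObj f V '' K z ∧
      robustObj f V '' K z ⊆ upHull E := fun z hz => by
    refine exists_finite_generators_of_isHPolyhedron (hK z).1 (hK z).2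
      (fun i (ξ : V) => dotProductBilin ℝ ℝ (c i ξ)) (fun x hx i r => ?_)
      (hcont.mono (hKX z hz))
    rw [robustObj_le_iff hV hne, Subtype.forall]
    refine forall₂_congr fun ξ hξ => ?_
    rw [hc i ξ hξ x (hKX z hz hx)]
    rfl
  choose! E hEfin hEsub hEgen using hE
  refine ⟨⋃ z ∈ Z, E z, hZ.biUnion hEfin, ?_, ?_⟩
  · exact Set.iUnion₂_subset fun z hz => (hEsub z hz).trans (Set.image_mono (hKX z hz))
  · rintro _ ⟨x, hx, rfl⟩
    rw [hX] at hx
    obtain ⟨z, hz, hxz⟩ := Set.mem_iUnion₂.1 hx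
    exact upHull_mono (Set.subset_biUnion_of_mem hz) (hEgen z hz ⟨x, hxz, rfl⟩)

end RobustObj

/-! ### Worst cases at extreme points -/

/-- The convex hull of a finite set or a polytope has finitely many extreme points and is their
convex hull. -/
theorem extremePoints_convexHull_spec {m : ℕ} {U : Set (Fin m → ℝ)}
    (hU : U.Finite ∨ IsPolytope U) :
    (Set.extremePoints ℝ (convexHull ℝ U)).Finite ∧
      convexHull ℝ (Set.extremePoints ℝ (convexHull ℝ U)) = convexHull ℝ U := by
  have h : (Set.extremePoints ℝ (convexHull ℝ U)).Finite ∧ IsCompact (convexHull ℝ U) := by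
    rcases hU with hU | hU
    · exact ⟨hU.subset extremePoints_convexHull_subset, hU.isCompact_convexHull ℝ⟩
    · rw [hU.isHPolyhedron.convex.convexHull_eq]
      exact ⟨hU.isHPolyhedron.finite_extremePoints, hU.isCompact⟩
  exact ⟨h.1, h.2.convexHull_extremePoints (convex_convexHull ℝ U) h.1⟩

/-- A quasiconvex function on the convex hull of a finite set or a polytope has a maximizer that is
an extreme point. -/
theorem QuasiconvexOn.exists_argmax_extremePoint {m : ℕ} {U : Set (Fin m → ℝ)}
    (hU : U.Finite ∨ IsPolytope U) (hne : U.Nonempty) {h : (Fin m → ℝ) → ℝ}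
    (hq : QuasiconvexOn ℝ (convexHull ℝ U) h) :
    (argmaxSet h U ∩ Set.extremePoints ℝ (convexHull ℝ U)).Nonempty := by
  obtain ⟨hfin, hconv⟩ := extremePoints_convexHull_spec hU
  have hne' : (Set.extremePoints ℝ (convexHull ℝ U)).Nonempty := by
    rw [← convexHull_nonempty_iff (𝕜 := ℝ), hconv]
    exact hne.convexHull
  obtain ⟨ξ, hξ, hmax⟩ := Set.exists_max_image _ h hfin hne'
  refine ⟨ξ, ⟨extremePoints_convexHull_subset hξ, fun ζ hζ => ?_⟩, hξ⟩
  -- The sublevel set at the best extreme point is convex and contains all extreme points, hence the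
  -- whole hull.
  have hsub : Set.extremePoints ℝ (convexHull ℝ U) ⊆ {η | η ∈ convexHull ℝ U ∧ h η ≤ h ξ} :=
    fun η hη => ⟨hη.1, hmax η hη⟩
  have := convexHull_min hsub (hq (h ξ))
  rw [hconv] at this
  exact (this (subset_convexHull ℝ U hζ)).2

/-! ### The outer loop -/

section RobustOptimizer

variable {n m : ℕ} {X : Set (Fin n → ℝ)} {U V W : Set (Fin m → ℝ)}
  {f : Fin 2 → (Fin n → ℝ) → (Fin m → ℝ) → ℝ} {b N : ℕ}

/-- Once V contains a worst case of x, its value at x is exact. This is why a failed stopping test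
yields a new scenario. -/
theorem robustObj_eq_of_mem_argmaxSet {x : Fin n → ℝ} {i : Fin 2} {w : Fin m → ℝ}
    (hw : w ∈ argmaxSet (f i x) U) (hV : V ⊆ U) (hwV : w ∈ V) : robustObj f V x i = f i x w := by
  refine IsGreatest.csSup_eq ⟨⟨w, hwV, rfl⟩, ?_⟩
  rintro _ ⟨ξ, hξ, rfl⟩
  exact hw.2 ξ (hV hξ)

/-- Attained maxima are needed because `sSup` of a set unbounded above is 0, which would break
monotonicity in the scenario set. -/
theorem robustObj_le_of_subset {x : Fin n → ℝ} (hU : ∀ i, (argmaxSet (f i x) U).Nonempty)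
    (hV : V ⊆ U) (hne : V.Nonempty) : robustObj f V x ≤ robustObj f U x := by
  intro i
  obtain ⟨w, hw⟩ := hU i
  rw [robustObj_eq_of_mem_argmaxSet hw subset_rfl hw.1]
  refine csSup_le (hne.image _) ?_
  rintro _ ⟨ξ, hξ, rfl⟩
  exact hw.2 ξ (hV hξ)

/-- The scenario set `V` after `k` iterations: it contains at least `b + k` points of `W`. -/
structure ScenarioInv (U W : Set (Fin m → ℝ)) (b k : ℕ) (V : Set (Fin m → ℝ)) : Prop where
  subset : V ⊆ U
  finite : V.Finite
  nonempty : V.Nonempty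
  card : b + k ≤ (V ∩ W).ncard

/-- The invariant of the robust optimizer's approach. -/
def ROAInv (X : Set (Fin n → ℝ)) (U : Set (Fin m → ℝ))
    (f : Fin 2 → (Fin n → ℝ) → (Fin m → ℝ) → ℝ) (W : Set (Fin m → ℝ)) (b N : ℕ) :
    ROAState n m → Prop
  | .loop k V => ScenarioInv U W b k V
  | .search k V s => ScenarioInv U W b k V ∧ DichInv X (robustObj f V) s
  | .pess k V R _ => ScenarioInv U W b k V ∧ R.Finite ∧ R ⊆ X ∧
      Represents (robustObj f V '' X) (robustObj f V '' R) ∧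
      irredundant (robustObj f V '' R) = robustObj f V '' R
  | .done k R _ _ => k ≤ N ∧ IsRepresentativeESE X (robustObj f U) R

/-- An iteration that is not the last one adds a scenario in `W`. -/
theorem ScenarioInv.ssubset {k : ℕ} (hV : ScenarioInv U W b k V) {R : Set (Fin n → ℝ)}
    {w : (Fin n → ℝ) → Fin 2 → Fin m → ℝ} (hw : ∀ x ∈ R, ∀ i, w x i ∈ argmaxSet (f i x) U ∩ W)
    (h : ¬ ∀ x ∈ R, robustObj f U x = robustObj f V x) :
    V ∩ W ⊂ (V ∪ {ξ | ∃ x ∈ R, ∃ i, ξ = w x i}) ∩ W := by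
  push Not at h
  obtain ⟨x, hx, hne⟩ := h
  obtain ⟨i, hi⟩ := Function.ne_iff.1 hne
  have hwi := hw x hx i
  refine (Set.ssubset_iff_of_subset (Set.inter_subset_inter_left _ Set.subset_union_left)).2
    ⟨w x i, ⟨Or.inr ⟨x, hx, i, rfl⟩, hwi.2⟩, fun hmem => hi ?_⟩
  rw [robustObj_eq_of_mem_argmaxSet hwi.1 subset_rfl hwi.1.1,
    robustObj_eq_of_mem_argmaxSet hwi.1 hV.subset hmem.1]

theorem ScenarioInv.succ {k : ℕ} (hV : ScenarioInv U W b k V) (hW : W.Finite)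
    {R : Set (Fin n → ℝ)} (hR : R.Finite)
    {w : (Fin n → ℝ) → Fin 2 → Fin m → ℝ} (hw : ∀ x ∈ R, ∀ i, w x i ∈ argmaxSet (f i x) U ∩ W)
    (h : ¬ ∀ x ∈ R, robustObj f U x = robustObj f V x) :
    ScenarioInv U W b (k + 1) (V ∪ {ξ | ∃ x ∈ R, ∃ i, ξ = w x i}) := by
  refine ⟨Set.union_subset hV.subset ?_, hV.finite.union ?_, hV.nonempty.inl, ?_⟩
  · rintro _ ⟨x, hx, i, rfl⟩
    exact (hw x hx i).1.1
  · refine ((hR.prod (Set.finite_univ (α := Fin 2))).image fun q => w q.1 q.2).subset ?_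
    rintro _ ⟨x, hx, i, rfl⟩
    exact ⟨(x, i), ⟨hx, Set.mem_univ _⟩, rfl⟩
  · have := Set.ncard_lt_ncard (hV.ssubset hw h) (hW.subset Set.inter_subset_right)
    have := hV.card
    omega

theorem ROAInv.step (hW : W.Finite)
    (hmax : ∀ x ∈ X, ∀ i, (argmaxSet (f i x) U ∩ W).Nonempty) (hN : W.ncard + 1 ≤ b + N)
    {s t : ROAState n m} (hs : ROAInv X U f W b N s) (h : ROAStep X U f W s t) :
    ROAInv X U f W b N t := by
  cases h with
  | start k V s h => exact ⟨hs, h.dichInv⟩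
  | inner k V s t h => exact ⟨hs.1, hs.2.step h⟩
  | finish k V s h =>
    obtain ⟨hV, hD⟩ := hs
    have hfin : s.points.Finite := by
      rw [← hD.image_sols]
      exact hD.sols_finite.image _
    refine ⟨hV, hD.sols_finite.subset fun x hx => hx.1, fun x hx => hD.sols_subset hx.1, ?_, ?_⟩
    · rw [hD.image_cleanSols, s.cleanPoints_eq]
      exact (hD.represents h).irredundant hfin
    · rw [hD.image_cleanSols, s.cleanPoints_eq, irredundant_irredundant]
  | again k V R Y w hw h => exact hs.1.succ hW hs.2.1 hw h
  | halt k V R Y w hw h =>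
    obtain ⟨hV, hR, hRX, hrep, hirr⟩ := hs
    constructor
    -- The last iteration need not add a scenario. From b + k ≤ |V ∩ W| ≤ |W| and |W| + 1 ≤ b + N
    -- follows k + 1 ≤ N.
    · have h1 := hV.card
      have h2 := Set.ncard_le_ncard (Set.inter_subset_right (s := V) (t := W)) hW
      omega
    · have htr := hrep.transfer hRX (fun x hx => robustObj_le_of_subset
        (fun i => (hmax x hx i).mono Set.inter_subset_left) hV.subset hV.nonempty) h
      refine ⟨hRX, ?_⟩
      rw [← htr.irredundant_eq, Set.image_congr h, hirr]

theorem ROAInv.exists_step (hX : IsCompact X) (hXne : X.Nonempty)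
    (hcont : ∀ V ⊆ U, V.Finite → V.Nonempty → ContinuousOn (robustObj f V) X)
    (hmax : ∀ x ∈ X, ∀ i, (argmaxSet (f i x) U ∩ W).Nonempty)
    {s : ROAState n m} (hs : ROAInv X U f W b N s) :
    (∃ t, ROAStep X U f W s t) ∨ ∃ k R Y V, s = .done k R Y V := by
  cases s with
  | loop k V =>
    obtain ⟨s, h⟩ := exists_dichInit hX hXne (hcont V hs.subset hs.finite hs.nonempty)
    exact Or.inl ⟨_, .start k V s h⟩
  | search k V s =>
    rcases s.pending.eq_empty_or_nonempty with h | h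
    · exact Or.inl ⟨_, .finish k V s h⟩
    · obtain ⟨t, ht⟩ := DichInv.exists_step hX hXne
        (hcont V hs.1.subset hs.1.finite hs.1.nonempty) h
      exact Or.inl ⟨_, .inner k V s t ht⟩
  | pess k V R Y =>
    have hw : ∀ x i, ∃ ξ, x ∈ R → ξ ∈ argmaxSet (f i x) U ∩ W := fun x i => by
      by_cases hx : x ∈ R
      · obtain ⟨ξ, hξ⟩ := hmax x (hs.2.2.1 hx) i
        exact ⟨ξ, fun _ => hξ⟩
      · exact ⟨0, fun h => absurd h hx⟩
    choose w hw using hw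
    by_cases h : ∀ x ∈ R, robustObj f U x = robustObj f V x
    · exact Or.inl ⟨_, .halt k V R Y w (fun x hx i => hw x i hx) h⟩
    · exact Or.inl ⟨_, .again k V R Y w (fun x hx i => hw x i hx) h⟩
  | done k R Y V => exact Or.inr ⟨k, R, Y, V, rfl⟩

/-- The inner half of a lexicographic termination argument: k and V stay fixed during dichotomic
search, and its only exit is to pessimization. -/
theorem ROAInv.acc_search (hW : W.Finite)
    (hmax : ∀ x ∈ X, ∀ i, (argmaxSet (f i x) U ∩ W).Nonempty) (hN : W.ncard + 1 ≤ b + N) {k : ℕ}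
    (hpess : ∀ R Y, ROAInv X U f W b N (.pess k V R Y) →
      Acc (fun t s => ROAStep X U f W s t) (.pess k V R Y))
    {s : DichState n} (hacc : Acc (fun t s => DichStep X (robustObj f V) s t) s)
    (hs : ROAInv X U f W b N (.search k V s)) :
    Acc (fun t s => ROAStep X U f W s t) (.search k V s) := by
  induction hacc with
  | intro s _ ih =>
    refine Acc.intro _ fun t ht => ?_
    have hinv := hs.step hW hmax hN ht
    cases ht with
    | inner _ _ _ t h => exact ih t h hinv
    | finish _ _ _ h => exact hpess _ _ hinv

theorem ROAInv.acc_loop (hW : W.Finite)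
    (hgen : ∀ V ⊆ U, V.Finite → V.Nonempty → ∃ E : Set (Fin 2 → ℝ), E.Finite ∧
      E ⊆ robustObj f V '' X ∧ robustObj f V '' X ⊆ upHull E)
    (hmax : ∀ x ∈ X, ∀ i, (argmaxSet (f i x) U ∩ W).Nonempty) (hN : W.ncard + 1 ≤ b + N) {k : ℕ}
    (hs : ROAInv X U f W b N (.loop k V)) :
    Acc (fun t s => ROAStep X U f W s t) (.loop k V) := by
  -- The outer measure: the number of points of W still missing from V.
  obtain ⟨d, hd⟩ : ∃ d, W.ncard - (V ∩ W).ncard = d := ⟨_, rfl⟩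
  induction d using Nat.strong_induction_on generalizing k V with
  | _ d ih =>
    have hV : ScenarioInv U W b k V := hs
    refine Acc.intro _ fun t ht => ?_
    have hinv := hs.step hW hmax hN ht
    cases ht with
    | start _ _ s h =>
      obtain ⟨E, hE, hEsub, hEgen⟩ := hgen V hV.subset hV.finite hV.nonempty
      refine ROAInv.acc_search hW hmax hN (fun R Y hR => Acc.intro _ fun t ht => ?_)
        (h.dichInv.acc hE.toFinset (by simpa using hEsub) (by simpa using hEgen)) hinv
      have hinv' := hR.step hW hmax hN ht
      cases ht with
      | again _ _ _ _ w hw h =>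
        refine ih _ ?_ hinv' rfl
        have h1 := Set.ncard_lt_ncard (hV.ssubset hw h) (hW.subset Set.inter_subset_right)
        have h2 := Set.ncard_le_ncard (Set.inter_subset_right
          (s := V ∪ {ξ | ∃ x ∈ R, ∃ i, ξ = w x i}) (t := W)) hW
        omega
      | halt _ _ _ _ w hw h =>
        refine Acc.intro _ fun t ht => ?_
        cases ht

end RobustOptimizer

/-- Both parts of the theorem are instances, with W = U or W the set of extreme points. The initial
points of W are credited against the iteration bound. -/
theorem roaWorks {n m : ℕ} {P : Set (Fin n → ℝ)} (hP : IsPolytope P) {k : ℕ}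
    (hX : (mixedIntegerPart P k).Nonempty) {U : Set (Fin m → ℝ)}
    {f : Fin 2 → (Fin n → ℝ) → (Fin m → ℝ) → ℝ}
    (hlin : ∀ i, ∀ ξ ∈ U, ∃ c : Fin n → ℝ, ∀ x ∈ mixedIntegerPart P k, f i x ξ = c ⬝ᵥ x)
    {W : Set (Fin m → ℝ)} (hW : W.Finite)
    (hmax : ∀ x ∈ mixedIntegerPart P k, ∀ i, (argmaxSet (f i x) U ∩ W).Nonempty)
    {U₀ : Set (Fin m → ℝ)} (hU₀U : U₀ ⊆ U) (hU₀fin : U₀.Finite) (hU₀ne : U₀.Nonempty) {N : ℕ}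
    (hN : W.ncard + 1 ≤ (U₀ ∩ W).ncard + N) :
    ROAWorks (mixedIntegerPart P k) U f W U₀ N := by
  have h0 : ROAInv (mixedIntegerPart P k) U f W (U₀ ∩ W).ncard N (.loop 0 U₀) :=
    ⟨hU₀U, hU₀fin, hU₀ne, le_rfl⟩
  have hreach : ∀ s, Relation.ReflTransGen (ROAStep (mixedIntegerPart P k) U f W) (.loop 0 U₀) s →
      ROAInv (mixedIntegerPart P k) U f W (U₀ ∩ W).ncard N s := by
    intro s hs
    induction hs with
    | refl => exact h0
    | tail _ h ih => exact ih.step hW hmax hN h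
  refine ⟨h0.acc_loop hW (fun V hVU hV hne => exists_finite_generators hP k hV hne
    fun i ξ hξ => hlin i ξ (hVU hξ)) hmax hN, fun s hs => ?_, fun k R Y V h => hreach _ h⟩
  exact (hreach s hs).exists_step (hP.isCompact_mixedIntegerPart k) hX
    (fun V hVU hV hne => continuousOn_robustObj hV hne fun i ξ hξ => hlin i ξ (hVU hξ)) hmax

theorem mainTheorem1 {n m : ℕ}
    (P : Set (Fin n → ℝ)) (hP : IsPolytope P) (k : ℕ) (hk : k ≤ n)
    (hX : (mixedIntegerPart P k).Nonempty)
    (U : Set (Fin m → ℝ)) (hU : U.Finite ∨ IsPolytope U)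
    (f : Fin 2 → (Fin n → ℝ) → (Fin m → ℝ) → ℝ)
    (hlin : ∀ i, ∀ ξ ∈ U, ∃ c : Fin n → ℝ, ∀ x ∈ mixedIntegerPart P k, f i x ξ = c ⬝ᵥ x)
    (U₀ : Set (Fin m → ℝ)) (hU₀U : U₀ ⊆ U) (hU₀fin : U₀.Finite) (hU₀ne : U₀.Nonempty) :
    -- finite uncertainty set, arbitrary worst-case scenarios
    (U.Finite → ROAWorks (mixedIntegerPart P k) U f U U₀ U.ncard) ∧
    -- finite or polytopal uncertainty set, worst-case scenarios that are vertices
    ((∀ i, ∀ x ∈ mixedIntegerPart P k,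
        ContinuousOn (f i x) (convexHull ℝ U) ∧ QuasiconvexOn ℝ (convexHull ℝ U) (f i x)) →
      ((U₀ ∩ Set.extremePoints ℝ (convexHull ℝ U)).Nonempty →
        ROAWorks (mixedIntegerPart P k) U f (Set.extremePoints ℝ (convexHull ℝ U)) U₀
          (Set.extremePoints ℝ (convexHull ℝ U)).ncard) ∧
      ROAWorks (mixedIntegerPart P k) U f (Set.extremePoints ℝ (convexHull ℝ U)) U₀
        ((Set.extremePoints ℝ (convexHull ℝ U)).ncard + 1)) := by
  have hUne : U.Nonempty := hU₀ne.mono hU₀U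
  constructor
  · intro hUfin
    refine roaWorks hP hX hlin hUfin (fun x _ i => ?_) hU₀U hU₀fin hU₀ne ?_
    · obtain ⟨ξ, hξ, hmax⟩ := Set.exists_max_image U (f i x) hUfin hUne
      exact ⟨ξ, ⟨hξ, hmax⟩, hξ⟩
    -- The initial scenarios all lie in W = U, so at least one is credited and pays for the final
    -- iteration.
    · rw [Set.inter_eq_left.2 hU₀U]
      have := (Set.ncard_pos hU₀fin).2 hU₀ne
      omega
  · intro hq
    have hfin := (extremePoints_convexHull_spec hU).1
    have hmax : ∀ x ∈ mixedIntegerPart P k, ∀ i,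
        (argmaxSet (f i x) U ∩ Set.extremePoints ℝ (convexHull ℝ U)).Nonempty :=
      fun x hx i => (hq i x hx).2.exists_argmax_extremePoint hU hUne
    refine ⟨fun hne => roaWorks hP hX hlin hfin hmax hU₀U hU₀fin hU₀ne ?_,
      -- With no extreme point guaranteed at the start, nothing is credited and the final iteration
      -- costs one more.
      roaWorks hP hX hlin hfin hmax hU₀U hU₀fin hU₀ne (by omega)⟩
    have := (Set.ncard_pos (hU₀fin.subset Set.inter_subset_left)).2 hne
    omega
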